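/- \textbf{Setting.} All graphs are finite and simple. Let $G$ be an interval graph and let $\mathcal R'$ be a partial representation of $G$: some vertices $v$ are pre-drawn as closed intervals $\langle v\rangle'=[\ell(v),r(v)]$ with $\ell(v)\le r(v)$, and two distinct pre-drawn vertices are adjacent if and only if their intervals intersect. For a maximal clique $a$, let $J_a$ be the set of points of $\mathbb R$ covered by all pre-drawn intervals of vertices in $a$ and by no other pre-drawn interval; put $\curvearrowleft(a)=\inf J_a$ and $\curvearrowright(a)=\sup J_a$ in $[-\infty,\infty]$ (with $\inf\emptyset=+\infty$, $\sup\emptyset=-\infty$), and write $a\vartriangleleft b$ if $\curvearrowright(a)\le\curvearrowleft(b)$. The (M)PQ-tree $T$ of $G$ is the rooted ordered tree whose leaves are the maximal cliques of $G$, with P-nodes (at least two children, which may be permuted arbitrarily) and Q-nodes (at least three children, whose order may only be reversed), such that the represented orderings of the leaves are exactly the orderings of the maximal cliques in which, for each vertex, the cliques containing it are consecutive. Let $Q$ be a Q-node of $T$ with subtrees $T_1,\dots,T_n$. A set $S$ of maximal cliques lying in $T_1,\dots,T_n$ \emph{creates an obstruction of $Q$} if neither of the two orderings of $Q$ is compatible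 with $\vartriangleleft$ on $S$, i.e. there are $a,b,c,d\in S$ with $a\in T_\alpha$, $b\in T_\beta$, $c\in T_\gamma$, $d\in T_\delta$, $\alpha<\beta$, $\gamma<\delta$, $a\vartriangleleft b$ and $d\vartriangleleft c$. \textbf{Obstructions.} $G$ and $\mathcal R'$ contain one of the following obstructions if the listed vertices can be found in $G$ with the listed properties (vertices not declared pre-drawn are arbitrary). A set avoids $N[y]$ if it contains neither $y$ nor a neighbour of $y$. The interval of $y$ is between those of $x$ and $z$ if the three intervals are pairwise disjoint and occur in the order $x,y,z$ or $z,y,x$ from left to right. \begin{itemize} \item \emph{SE}: pre-drawn $u,v$ (possibly $u=v$) with $r(u)=\ell(v)$, and two distinct non-adjacent vertices $x,y$, each adjacent to both $u$ and $v$. \item \emph{1-FAT}: pre-drawn $x_1,y_1,z_1$ with $\langle y_1\rangle'$ between $\langle x_1\rangle'$ and $\langle z_1\rangle'$, and an induced path $P_1$ from $x_1$ to $z_1$ avoiding $N[y_1]$. \item \emph{The graph $H_2$}: vertices $x_2,y_2,z_2,t_2,x_1$ and induced paths $P_1$ from $x_1$ to $y_2$ and $P_2$ from $x_2$ to $t_2$,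 where $x_1\ne y_2$, $x_2\neq t_2$, $P_1$ avoids $N[z_2]$; $t_2$ is adjacent to $z_2$ and to all vertices of $P_1$ except $x_1$ (with $t_2\ne x_1$); and every vertex of $P_2$ other than $t_2$ is different from and non-adjacent to $z_2$ and all vertices of $P_1$. \item \emph{2-FAT}: a graph $H_2$ in which $x_2,y_2,z_2$ are pre-drawn and $\langle y_2\rangle'$ is between $\langle x_2\rangle'$ and $\langle z_2\rangle'$. \item \emph{BI position of $x,z,u,v$}: $x,z,u,v$ are pre-drawn (possibly $u=v$), $\ell(u)\le\ell(v)\le r(u)\le r(v)$, $\ell(v)\in\langle x\rangle'$ and $r(u)\in\langle z\rangle'$. \item \emph{1-BI}: $x_1,z_1,u,v$ in BI position, a vertex $y_1$ and an induced path $P_1$ from $x_1$ to $z_1$ (possibly $x_1=z_1$) avoiding $N[y_1]$, such that $u$ and $v$ are both adjacent to $y_1$ and to all vertices of $P_1$. \item \emph{2-BI}: a graph $H_2$ and $u,v$ such that $x_2,z_2,u,v$ are in BI position and each of $u,v$ is either equal to $t_2$ or adjacent to all vertices of $H_2$; if one of $u,v$ equals $t_2$, the other one is also allowed to be adjacent to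 all vertices of $H_2$ except $x_1$. \end{itemize} \textbf{Lemma (The Q-node case, Two Subtrees).} Suppose that a set of at most three maximal cliques creates an obstruction of a Q-node $Q$ of the MPQ-tree of $G$, and that these cliques lie in two different subtrees of $Q$. Then $G$ and $\mathcal R'$ contain an SE, $1$-FAT, $2$-FAT, $1$-BI, or $2$-BI obstruction. -/

import Mathlib

/-! ### Partial interval representations -/

/-- A partial (interval) representation of `G`: the vertices of `dom` are pre-drawn, the vertex `v`
as the closed interval `[left v, right v]` (possibly of length zero), and these intervals represent
the subgraph of `G` induced by `dom`. The values of `left` and `right` outside `dom` are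
irrelevant. -/
structure PartialRep {V : Type*} (G : SimpleGraph V) where
  dom : Set V
  left : V → ℝ
  right : V → ℝ
  left_le_right : ∀ v ∈ dom, left v ≤ right v
  adj_iff : ∀ u ∈ dom, ∀ v ∈ dom, u ≠ v →
    (G.Adj u v ↔ (Set.Icc (left u) (right u) ∩ Set.Icc (left v) (right v)).Nonempty)

namespace PartialRep

variable {V : Type*} {G : SimpleGraph V} (R : PartialRep G)

/-- The pre-drawn interval of `v`. -/
def interval (v : V) : Set ℝ := Set.Icc (R.left v) (R.right v)

/-- The points of the real line covered by exactly those pre-drawn intervals which belong to the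
clique `K`: the only places where a clique-point of `K` may lie. -/
def region (K : Set V) : Set ℝ := {t | ∀ v ∈ R.dom, t ∈ R.interval v ↔ v ∈ K}

/-- The leftmost (limit) position for a clique-point of `K`. -/
noncomputable def leftmost (K : Set V) : EReal := sInf ((fun t : ℝ => (t : EReal)) '' R.region K)

/-- The rightmost (limit) position for a clique-point of `K`. -/
noncomputable def rightmost (K : Set V) : EReal := sSup ((fun t : ℝ => (t : EReal)) '' R.region K)

/-- The relation `K ◁ L` on maximal cliques. -/
def Prec (K L : Set V) : Prop := R.rightmost K ≤ R.leftmost L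

/-- The pre-drawn interval of `u` lies entirely to the left of the one of `v`. -/
def LeftOf (u v : V) : Prop := R.right u < R.left v

/-- The (pairwise disjoint) pre-drawn intervals of `x`, `y`, `z` are drawn with `y` in the
middle. -/
def Between (x y z : V) : Prop :=
  (R.LeftOf x y ∧ R.LeftOf y z) ∨ (R.LeftOf z y ∧ R.LeftOf y x)

end PartialRep

/-! ### PQ-trees

The MPQ-tree of an interval graph is its PQ-tree with the vertices of the graph additionally
assigned to the nodes; nodes, subtrees and leaves are those of the PQ-tree. -/

/-- Ordered trees with leaves labelled by `α` and with two kinds of inner nodes. -/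
inductive PQTree (α : Type*) where
  | leaf (a : α) : PQTree α
  | pnode (n : ℕ) (c : Fin n → PQTree α) : PQTree α
  | qnode (n : ℕ) (c : Fin n → PQTree α) : PQTree α

namespace PQTree

variable {α : Type*}

/-- P-nodes have at least two children, Q-nodes have at least three. -/
def WellFormed : PQTree α → Prop
  | leaf _ => True
  | pnode n c => 2 ≤ n ∧ ∀ i, (c i).WellFormed
  | qnode n c => 3 ≤ n ∧ ∀ i, (c i).WellFormed

/-- The set of labels of the leaves. -/
def leaves : PQTree α → Set α
  | leaf a => {a}
  | pnode _ c => ⋃ i, (c i).leaves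
  | qnode _ c => ⋃ i, (c i).leaves

/-- The orderings of the leaves represented by the tree: the children of a P-node may be permuted
arbitrarily, the order of the children of a Q-node may only be reversed. -/
def orders : PQTree α → Set (List α)
  | leaf a => {[a]}
  | pnode n c => {l | ∃ (f : Fin n → List α) (σ : Equiv.Perm (Fin n)),
      (∀ i, f i ∈ (c i).orders) ∧ l = (List.ofFn fun i => f (σ i)).flatten}
  | qnode n c => {l | ∃ f : Fin n → List α, (∀ i, f i ∈ (c i).orders) ∧
      (l = (List.ofFn f).flatten ∨ l = (List.ofFn fun i => f i.rev).flatten)}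

/-- `IsNode s t`: `s` is the subtree of `t` rooted at some node of `t`. -/
inductive IsNode (s : PQTree α) : PQTree α → Prop
  | root : IsNode s s
  | pchild (n : ℕ) (c : Fin n → PQTree α) (i : Fin n) : IsNode s (c i) → IsNode s (pnode n c)
  | qchild (n : ℕ) (c : Fin n → PQTree α) (i : Fin n) : IsNode s (c i) → IsNode s (qnode n c)

end PQTree

/-- `l` is a consecutive ordering of the maximal cliques of `G`: it lists each of them exactly once,
and for every vertex the maximal cliques containing it appear consecutively. -/
def IsConsecutiveOrdering {V : Type*} (G : SimpleGraph V) (l : List (Set V)) : Prop :=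
  l.Nodup ∧ (∀ K, K ∈ l ↔ Maximal G.IsClique K) ∧
    ∀ (v : V) (i j k : Fin l.length), i ≤ j → j ≤ k → v ∈ l.get i → v ∈ l.get k → v ∈ l.get j

/-- `T` is the PQ-tree of the interval graph `G`: the orderings represented by `T` are exactly the
consecutive orderings of the maximal cliques of `G`. -/
def IsPQTreeOf {V : Type*} (G : SimpleGraph V) (T : PQTree (Set V)) : Prop :=
  T.WellFormed ∧ ∀ l, l ∈ T.orders ↔ IsConsecutiveOrdering G l

/-- The cliques of `S`, taken from the subtrees `c 0, c 1, …` of a Q-node, create an obstruction of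
this Q-node: neither of the two orderings of the subtrees is compatible with `◁` on `S`. -/
def CreatesQObstruction {V : Type*} {G : SimpleGraph V} (R : PartialRep G) {n : ℕ}
    (c : Fin n → PQTree (Set V)) (S : Set (Set V)) : Prop :=
  (∀ K ∈ S, ∃ i, K ∈ (c i).leaves) ∧
  (∃ i j : Fin n, i < j ∧ ∃ K ∈ S, ∃ L ∈ S,
    K ∈ (c i).leaves ∧ L ∈ (c j).leaves ∧ R.Prec L K) ∧
  (∃ i j : Fin n, i < j ∧ ∃ K ∈ S, ∃ L ∈ S,
    K ∈ (c i).leaves ∧ L ∈ (c j).leaves ∧ R.Prec K L)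

/-! ### Obstructions

An obstruction is a graph with some pre-drawn vertices. It is contained in `G` and `R` when it is an
induced subgraph of `G` whose pre-drawn vertices are pre-drawn in `R` with the prescribed
left-to-right order of endpoints; vertices not said to be pre-drawn are arbitrary. -/

section Obstructions

variable {V : Type*} (G : SimpleGraph V)

/-- An induced path (possibly a single vertex). -/
def IsInducedPath {a b : V} (P : G.Walk a b) : Prop := P.IsPath ∧ P.IsChordless

/-- `y` is not in the closed neighbourhood of any vertex of `A` (`A` avoids `N[y]`). -/
def Avoids (y : V) (A : Set V) : Prop := ∀ s ∈ A, s ≠ y ∧ ¬ G.Adj s y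

/-- The graph `H₁` of a 1-FAT obstruction: an induced path from `x₁` to `z₁` avoiding `N[y₁]`. -/
def IsFATGraph1 (x₁ y₁ z₁ : V) (P₁ : G.Walk x₁ z₁) : Prop :=
  IsInducedPath G P₁ ∧ Avoids G y₁ {s | s ∈ P₁.support}

/-- The graph `H₂` of a 2-FAT obstruction: it arises from `H₁` (in the roles `y₁ = z₂`, `z₁ = y₂`)
by adding a vertex `t₂` adjacent to all vertices of `H₁` except for `x₁`, and an induced path from a
new vertex `x₂` to `t₂` whose vertices other than `t₂` have no neighbours in `H₁`. -/
structure IsFATGraph2 (x₂ y₂ z₂ t₂ x₁ : V) (P₂ : G.Walk x₂ t₂) (P₁ : G.Walk x₁ y₂) : Prop where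
  base : IsFATGraph1 G x₁ z₂ y₂ P₁
  x₁_ne_y₂ : x₁ ≠ y₂
  x₁_ne_t₂ : x₁ ≠ t₂
  not_adj_t₂_x₁ : ¬ G.Adj t₂ x₁
  adj_t₂_z₂ : G.Adj t₂ z₂
  adj_t₂ : ∀ s ∈ P₁.support, s ≠ x₁ → G.Adj t₂ s
  x₂_ne_t₂ : x₂ ≠ t₂
  induced : IsInducedPath G P₂
  avoids_z₂ : ∀ s ∈ P₂.support, s ≠ t₂ → Avoids G s {z₂}
  avoids_P₁ : ∀ s ∈ P₂.support, s ≠ t₂ → Avoids G s {w | w ∈ P₁.support}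

/-- The vertex set of `H₂`. -/
def fatVerts2 {G : SimpleGraph V} {x₂ y₂ t₂ x₁ : V} (z₂ : V) (P₂ : G.Walk x₂ t₂)
    (P₁ : G.Walk x₁ y₂) : Set V :=
  {s | s = z₂ ∨ s ∈ P₂.support ∨ s ∈ P₁.support}

variable {G} (R : PartialRep G)

/-- SE (shared endpoint) obstruction: pre-drawn `u`, `v` (possibly `u = v`, then of length zero)
sharing the endpoint `r(u) = ℓ(v)`, with two non-adjacent common neighbours. -/
def ContainsSE : Prop :=
  ∃ u ∈ R.dom, ∃ v ∈ R.dom, R.right u = R.left v ∧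
    ∃ x y, x ≠ y ∧ ¬ G.Adj x y ∧ G.Adj x u ∧ G.Adj x v ∧ G.Adj y u ∧ G.Adj y v

/-- 1-FAT (forced asteroidal triple) obstruction. -/
def Contains1FAT : Prop :=
  ∃ x₁ ∈ R.dom, ∃ y₁ ∈ R.dom, ∃ z₁ ∈ R.dom, R.Between x₁ y₁ z₁ ∧
    ∃ P₁ : G.Walk x₁ z₁, IsFATGraph1 G x₁ y₁ z₁ P₁

/-- 2-FAT obstruction. -/
def Contains2FAT : Prop :=
  ∃ x₂ ∈ R.dom, ∃ y₂ ∈ R.dom, ∃ z₂ ∈ R.dom, R.Between x₂ y₂ z₂ ∧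
    ∃ t₂ x₁, ∃ (P₂ : G.Walk x₂ t₂) (P₁ : G.Walk x₁ y₂), IsFATGraph2 G x₂ y₂ z₂ t₂ x₁ P₂ P₁

/-- The pre-drawn part of a `k`-BI obstruction. The vertices `x`, `z`, `u`, `v` are pre-drawn
(possibly `u = v`); the intervals of `u` and `v` intersect in `[ℓ(v), r(u)]`; the interval of `x`
covers `ℓ(v)` and the interval of `z` covers `r(u)`. -/
def IsBIPosition (x z u v : V) : Prop :=
  x ∈ R.dom ∧ z ∈ R.dom ∧ u ∈ R.dom ∧ v ∈ R.dom ∧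
    R.left u ≤ R.left v ∧ R.left v ≤ R.right u ∧ R.right u ≤ R.right v ∧
    R.left v ∈ R.interval x ∧ R.right u ∈ R.interval z

/-- 1-BI (blocked intersection) obstruction: `x₁`, `z₁`, `u`, `v` are in the above position, and
both `u` and `v` are adjacent to all vertices of `H₁`. -/
def Contains1BI : Prop :=
  ∃ x₁ z₁ u v, IsBIPosition R x₁ z₁ u v ∧
    ∃ y₁, ∃ P₁ : G.Walk x₁ z₁, IsFATGraph1 G x₁ y₁ z₁ P₁ ∧
      ∀ w, w = u ∨ w = v → G.Adj w y₁ ∧ ∀ s ∈ P₁.support, G.Adj w s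

/-- 2-BI obstruction: `x₂`, `z₂`, `u`, `v` are in the above position, and both `u` and `v` are
adjacent to `y₂`. Each of `u`, `v` is equal to `t₂` or adjacent to all vertices of `H₂`, except that,
if one of them is equal to `t₂`, the other one is allowed to be non-adjacent to `x₁` as well. -/
def Contains2BI : Prop :=
  ∃ x₂ z₂ u v, IsBIPosition R x₂ z₂ u v ∧
    ∃ y₂ t₂ x₁, ∃ (P₂ : G.Walk x₂ t₂) (P₁ : G.Walk x₁ y₂), IsFATGraph2 G x₂ y₂ z₂ t₂ x₁ P₂ P₁ ∧
      ∀ w, w = u ∨ w = v → w = t₂ ∨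
        ∀ s ∈ fatVerts2 z₂ P₂ P₁, G.Adj w s ∨ (s = x₁ ∧ (u = t₂ ∨ v = t₂))

end Obstructions

/-! With at most three cliques in two subtrees, the pairs violating the two orderings of the Q-node
must share a clique. So there are a clique `K` of one subtree `c i` and cliques `L`, `L'` of another
subtree `c j` with `L` ◁ `K` ◁ `L'`; this case is `containsObstruction_of_prec_prec`.

A clique with empty region gives 1-BI (`contains1BI_of_region_eq_empty`), and a common point of two
◁-related regions gives SE (`containsSE_of_region_inter`). Otherwise there are points `a < b < d` in
the regions of `L`, `K`, `L'`. Call a vertex universal if it lies in all cliques of `c j`, and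
private if it lies in some but not all of them. A universal pre-drawn interval covers `a` and `d`,
hence `b`, so its vertex lies in `K`. Therefore the pre-drawn vertices `x` of `L` and `z` of `L'`
outside `K`, found by a covering argument (`exists_predrawn_notMem`), are private.

If `K` has a non-universal pre-drawn vertex `y`, its interval separates those of `x` and `z`, and a
FAT obstruction arises. If all pre-drawn vertices of `K` are universal, then other intervals block
the parts of their intersection on both sides of the region of `K`, and a BI obstruction arises.

The structural core is `exists_nonadjacent`. By rigidity of the Q-node, from every `y` in `K`
missing `c j` one can walk, avoiding `c j`, to a non-neighbour `w` of some universal vertex `t`.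
Take a shortest such walk. In the FAT case, `w = y` gives the path `x, t, z` of 1-FAT and `w ≠ y`
gives the graph H₂. In the BI case, either the two covering vertices are joined by a path suitable
for 1-BI, or every universal vertex is adjacent to `y`, which forces `w ≠ y` and gives 2-BI. -/

/-! ### Orderings given by lists -/

/-- `x` occurs before `y` in the list `l`. -/
def Bef {α : Type*} (l : List α) (x y : α) : Prop := List.Sublist [x, y] l

namespace Bef

variable {α : Type*} {l l₁ l₂ : List α} {x y z : α}

lemma cons_iff {a : α} : Bef (a :: l) x y ↔ (x = a ∧ y ∈ l) ∨ Bef l x y := by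
  unfold Bef
  constructor
  · intro h
    cases h with
    | cons _ h => exact Or.inr h
    | cons_cons _ h => exact Or.inl ⟨rfl, by simpa using h⟩
  · rintro (⟨rfl, h⟩ | h)
    · exact List.Sublist.cons_cons _ (by simpa using h)
    · exact List.Sublist.cons _ h

lemma nil_iff : ¬ Bef ([] : List α) x y := by simp [Bef]

lemma mem_left (h : Bef l x y) : x ∈ l := h.subset (by simp)

lemma mem_right (h : Bef l x y) : y ∈ l := h.subset (by simp)

lemma mono (h : Bef l₁ x y) (hl : List.Sublist l₁ l₂) : Bef l₂ x y := List.Sublist.trans h hl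

lemma append_iff : Bef (l₁ ++ l₂) x y ↔ Bef l₁ x y ∨ Bef l₂ x y ∨ (x ∈ l₁ ∧ y ∈ l₂) := by
  induction l₁ with
  | nil => simp [nil_iff]
  | cons a l ih =>
    rw [List.cons_append, cons_iff, cons_iff, ih]
    simp only [List.mem_append, List.mem_cons]
    tauto

lemma reverse_iff : Bef l.reverse x y ↔ Bef l y x := by
  unfold Bef
  rw [← List.reverse_sublist]
  simp

lemma ne (hl : l.Nodup) (h : Bef l x y) : x ≠ y := by
  have := List.Nodup.sublist h hl
  simpa using this

lemma total (hx : x ∈ l) (hy : y ∈ l) (hxy : x ≠ y) : Bef l x y ∨ Bef l y x := by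
  induction l with
  | nil => simp at hx
  | cons a l ih =>
    simp only [cons_iff]
    rcases List.mem_cons.1 hx with rfl | hx'
    · rcases List.mem_cons.1 hy with rfl | hy'
      · exact absurd rfl hxy
      · exact Or.inl (Or.inl ⟨rfl, hy'⟩)
    · rcases List.mem_cons.1 hy with rfl | hy'
      · exact Or.inr (Or.inl ⟨rfl, hx'⟩)
      · rcases ih hx' hy' with h | h <;> tauto

lemma asymm (hl : l.Nodup) (h : Bef l x y) : ¬ Bef l y x := by
  induction l with
  | nil => exact absurd h nil_iff
  | cons a l ih =>
    rw [List.nodup_cons] at hl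
    rw [cons_iff] at h ⊢
    rintro (⟨rfl, h'⟩ | h')
    · rcases h with ⟨rfl, h⟩ | h
      · exact hl.1 h
      · exact hl.1 h.mem_right
    · rcases h with ⟨rfl, h⟩ | h
      · exact hl.1 h'.mem_right
      · exact ih hl.2 h h'

lemma trans (hl : l.Nodup) (h : Bef l x y) (h' : Bef l y z) : Bef l x z := by
  induction l with
  | nil => exact absurd h nil_iff
  | cons a l ih =>
    rw [List.nodup_cons] at hl
    rw [cons_iff] at h h' ⊢
    rcases h with ⟨rfl, h⟩ | h
    · rcases h' with ⟨rfl, h'⟩ | h'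
      · exact absurd h hl.1
      · exact Or.inl ⟨rfl, h'.mem_right⟩
    · rcases h' with ⟨rfl, h'⟩ | h'
      · exact absurd h.mem_right hl.1
      · exact Or.inr (ih hl.2 h h')

lemma iff_exists_get : Bef l x y ↔ ∃ i j : Fin l.length, i < j ∧ l.get i = x ∧ l.get j = y := by
  constructor
  · intro h
    obtain ⟨f, hf⟩ := List.sublist_iff_exists_fin_orderEmbedding_get_eq.1 h
    exact ⟨f ⟨0, by simp⟩, f ⟨1, by simp⟩, f.strictMono (by simp), (hf _).symm, (hf _).symm⟩
  · rintro ⟨i, j, hij, rfl, rfl⟩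
    induction l with
    | nil => exact i.elim0
    | cons a l ih =>
      rw [cons_iff]
      cases j using Fin.cases with
      | zero => exact absurd hij (Fin.not_lt_zero _)
      | succ j =>
        cases i using Fin.cases with
        | zero => left; simp
        | succ i => right; exact ih i j (by simpa using hij)

end Bef

lemma flatten_ofFn_of_forall_ne {α : Type*} {n : ℕ} (g : Fin n → List α) (i : Fin n)
    (h : ∀ k ≠ i, g k = []) : (List.ofFn g).flatten = g i := by
  induction n with
  | zero => exact i.elim0
  | succ n ih =>
    rw [List.ofFn_succ, List.flatten_cons]
    cases i using Fin.cases with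
    | zero =>
      have : (List.ofFn fun i : Fin n => g i.succ).flatten = [] := by
        simp only [List.flatten_eq_nil_iff, List.mem_ofFn]
        rintro _ ⟨k, rfl⟩
        exact h _ (Fin.succ_ne_zero k)
      rw [this, List.append_nil]
    | succ i =>
      rw [h 0 (Fin.succ_ne_zero i).symm, List.nil_append]
      exact ih (fun k => g k.succ) i fun k hk => h _ (by simpa using hk)

lemma bef_flatten_ofFn {α : Type*} {n : ℕ} (g : Fin n → List α) {i j : Fin n} (hij : i < j)
    {x y : α} (hx : x ∈ g i) (hy : y ∈ g j) : Bef (List.ofFn g).flatten x y := by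
  induction n with
  | zero => exact i.elim0
  | succ n ih =>
    rw [List.ofFn_succ, List.flatten_cons, Bef.append_iff]
    cases j using Fin.cases with
    | zero => exact absurd hij (Fin.not_lt_zero _)
    | succ j =>
      cases i using Fin.cases with
      | zero =>
        refine Or.inr (Or.inr ⟨hx, ?_⟩)
        simp only [List.mem_flatten, List.mem_ofFn]
        exact ⟨_, ⟨j, rfl⟩, hy⟩
      | succ i => exact Or.inr (Or.inl (ih (fun k => g k.succ) (by simpa using hij) hx hy))

lemma mem_flatten_ofFn {α : Type*} {n : ℕ} (g : Fin n → List α) {x : α} :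
    x ∈ (List.ofFn g).flatten ↔ ∃ i, x ∈ g i := by
  simp [List.mem_flatten, List.mem_ofFn]

/-- Replacing the list at a single index changes only one segment of the concatenation. This is what
allows one subtree to be reordered while the rest of the tree stays frozen. -/
lemma exists_flatten_ofFn_update {α : Type*} {n : ℕ} (g : Fin n → List α) (i : Fin n) :
    ∃ l₁ l₂, ∀ m, (List.ofFn (Function.update g i m)).flatten = l₁ ++ m ++ l₂ := by
  induction n with
  | zero => exact i.elim0
  | succ n ih =>
    cases i using Fin.cases with
    | zero =>
      refine ⟨[], (List.ofFn fun k : Fin n => g k.succ).flatten, fun m => ?_⟩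
      rw [List.ofFn_succ, List.flatten_cons]
      simp
    | succ i =>
      obtain ⟨l₁, l₂, h⟩ := ih (fun k => g k.succ) i
      refine ⟨g 0 ++ l₁, l₂, fun m => ?_⟩
      rw [List.ofFn_succ, List.flatten_cons]
      have := h m
      have h2 : (fun k : Fin n => Function.update g i.succ m k.succ)
          = Function.update (fun k => g k.succ) i m := by
        funext k
        simp [Function.update_apply]
      rw [h2, this]
      simp [(Fin.succ_ne_zero i).symm]

lemma reverse_flatten_ofFn {α : Type*} {n : ℕ} (g : Fin n → List α) :
    (List.ofFn g).flatten.reverse = (List.ofFn fun i => (g i.rev).reverse).flatten := by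
  rw [List.reverse_flatten, List.map_ofFn]
  congr 1
  refine List.ext_getElem (by simp) fun k h₁ h₂ => ?_
  have hk : k < n := by simpa using h₁
  have : n - 1 - k = n - (k + 1) := by omega
  simp [Fin.rev, this]

/-! ### Orders represented by a PQ-tree -/

namespace PQTree

variable {α : Type*}

lemma orders_nonempty (t : PQTree α) : t.orders.Nonempty := by
  induction t with
  | leaf a => exact ⟨[a], rfl⟩
  | pnode n c ih =>
    choose f hf using ih
    exact ⟨_, f, 1, hf, rfl⟩
  | qnode n c ih =>
    choose f hf using ih
    exact ⟨_, f, hf, Or.inl rfl⟩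

lemma mem_iff_of_mem_orders (t : PQTree α) {l : List α} (hl : l ∈ t.orders) (x : α) :
    x ∈ l ↔ x ∈ t.leaves := by
  induction t generalizing l with
  | leaf a =>
    obtain rfl : l = [a] := hl
    simp [leaves]
  | pnode n c ih =>
    obtain ⟨f, σ, hf, rfl⟩ := hl
    simp only [mem_flatten_ofFn, leaves, Set.mem_iUnion, ← ih _ (hf _)]
    exact ⟨fun ⟨i, h⟩ => ⟨_, h⟩, fun ⟨i, h⟩ => ⟨σ.symm i, by simpa using h⟩⟩
  | qnode n c ih =>
    obtain ⟨f, hf, rfl | rfl⟩ := hl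
    · simp only [mem_flatten_ofFn, leaves, Set.mem_iUnion, ← ih _ (hf _)]
    · simp only [mem_flatten_ofFn, leaves, Set.mem_iUnion, ← ih _ (hf _)]
      exact ⟨fun ⟨i, h⟩ => ⟨_, h⟩, fun ⟨i, h⟩ => ⟨i.rev, by simpa using h⟩⟩

lemma leaves_nonempty {t : PQTree α} (ht : t.WellFormed) : t.leaves.Nonempty := by
  induction t with
  | leaf a => exact ⟨a, rfl⟩
  | pnode n c ih =>
    obtain ⟨x, hx⟩ := ih ⟨0, by have := ht.1; omega⟩ (ht.2 _)
    exact ⟨x, Set.mem_iUnion.2 ⟨_, hx⟩⟩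
  | qnode n c ih =>
    obtain ⟨x, hx⟩ := ih ⟨0, by have := ht.1; omega⟩ (ht.2 _)
    exact ⟨x, Set.mem_iUnion.2 ⟨_, hx⟩⟩

lemma reverse_mem_orders (t : PQTree α) {l : List α} (hl : l ∈ t.orders) :
    l.reverse ∈ t.orders := by
  induction t generalizing l with
  | leaf a =>
    obtain rfl : l = [a] := hl
    rfl
  | pnode n c ih =>
    obtain ⟨f, σ, hf, rfl⟩ := hl
    exact ⟨fun i => (f i).reverse, Fin.revPerm.trans σ, fun i => ih i (hf i),
      reverse_flatten_ofFn _⟩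
  | qnode n c ih =>
    obtain ⟨f, hf, rfl | rfl⟩ := hl
    · exact ⟨fun i => (f i).reverse, fun i => ih i (hf i), Or.inr (reverse_flatten_ofFn _)⟩
    · refine ⟨fun i => (f i).reverse, fun i => ih i (hf i), Or.inl ?_⟩
      rw [reverse_flatten_ofFn]
      simp

lemma IsNode.trans {r s t : PQTree α} (hrs : IsNode r s) (hst : IsNode s t) : IsNode r t := by
  induction hst with
  | root => exact hrs
  | pchild n c i _ ih => exact .pchild n c i ih
  | qchild n c i _ ih => exact .qchild n c i ih

lemma IsNode.wellFormed {s t : PQTree α} (h : IsNode s t) (ht : t.WellFormed) : s.WellFormed := by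
  induction h with
  | root => exact ht
  | pchild n c i _ ih => exact ih (ht.2 i)
  | qchild n c i _ ih => exact ih (ht.2 i)

lemma IsNode.leaves_subset {s t : PQTree α} (h : IsNode s t) : s.leaves ⊆ t.leaves := by
  induction h with
  | root => exact subset_rfl
  | pchild n c i _ ih => exact ih.trans (Set.subset_iUnion (fun i => (c i).leaves) i)
  | qchild n c i _ ih => exact ih.trans (Set.subset_iUnion (fun i => (c i).leaves) i)

lemma pnode_context {n : ℕ} (c : Fin n → PQTree α) (i : Fin n) :
    ∃ l₁ l₂, ∀ m ∈ (c i).orders, l₁ ++ m ++ l₂ ∈ (pnode n c).orders := by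
  choose f hf using fun i => (c i).orders_nonempty
  obtain ⟨l₁, l₂, h⟩ := exists_flatten_ofFn_update f i
  refine ⟨l₁, l₂, fun m hm => ⟨Function.update f i m, 1, fun k => ?_, (h m).symm⟩⟩
  by_cases hk : k = i
  · subst hk; simpa using hm
  · simpa [hk] using hf k

lemma qnode_context {n : ℕ} (c : Fin n → PQTree α) (i : Fin n) :
    ∃ l₁ l₂, ∀ m ∈ (c i).orders, l₁ ++ m ++ l₂ ∈ (qnode n c).orders := by
  choose f hf using fun i => (c i).orders_nonempty
  obtain ⟨l₁, l₂, h⟩ := exists_flatten_ofFn_update f i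
  refine ⟨l₁, l₂, fun m hm => ⟨Function.update f i m, fun k => ?_, Or.inl (h m).symm⟩⟩
  by_cases hk : k = i
  · subst hk; simpa using hm
  · simpa [hk] using hf k

/-- A fixed ordering of the rest of the tree can be combined with every ordering of a subtree. -/
lemma IsNode.context {s t : PQTree α} (h : IsNode s t) :
    ∃ l₁ l₂, ∀ m ∈ s.orders, l₁ ++ m ++ l₂ ∈ t.orders := by
  induction h with
  | root => exact ⟨[], [], fun m hm => by simpa using hm⟩
  | pchild n c i _ ih =>
    obtain ⟨l₁, l₂, h⟩ := ih
    obtain ⟨k₁, k₂, h'⟩ := pnode_context c i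
    exact ⟨k₁ ++ l₁, l₂ ++ k₂, fun m hm => by simpa using h' _ (h m hm)⟩
  | qchild n c i _ ih =>
    obtain ⟨l₁, l₂, h⟩ := ih
    obtain ⟨k₁, k₂, h'⟩ := qnode_context c i
    exact ⟨k₁ ++ l₁, l₂ ++ k₂, fun m hm => by simpa using h' _ (h m hm)⟩

/-- No label occurs twice in a represented ordering. -/
def NodupOrders (t : PQTree α) : Prop := ∀ l ∈ t.orders, l.Nodup

lemma IsNode.nodupOrders {s t : PQTree α} (h : IsNode s t) (ht : t.NodupOrders) :
    s.NodupOrders := by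
  obtain ⟨l₁, l₂, hl⟩ := h.context
  intro m hm
  exact (List.nodup_append.1 (List.nodup_append.1 (ht _ (hl m hm))).1).2.1

lemma disjoint_of_nodup_flatten {n : ℕ} {c : Fin n → PQTree α} {f : Fin n → List α}
    (hf : ∀ i, f i ∈ (c i).orders) (h : (List.ofFn f).flatten.Nodup) {i j : Fin n}
    {x : α} (hi : x ∈ (c i).leaves) (hj : x ∈ (c j).leaves) : i = j := by
  rw [← (c i).mem_iff_of_mem_orders (hf i)] at hi
  rw [← (c j).mem_iff_of_mem_orders (hf j)] at hj
  by_contra hne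
  rcases lt_or_gt_of_ne hne with hlt | hlt
  · exact (bef_flatten_ofFn f hlt hi hj).ne h rfl
  · exact (bef_flatten_ofFn f hlt hj hi).ne h rfl

lemma pnode_leaves_disjoint {n : ℕ} {c : Fin n → PQTree α} (h : (pnode n c).NodupOrders)
    {i j : Fin n} {x : α} (hi : x ∈ (c i).leaves) (hj : x ∈ (c j).leaves) : i = j := by
  choose f hf using fun i => (c i).orders_nonempty
  exact disjoint_of_nodup_flatten hf (h _ ⟨f, 1, hf, rfl⟩) hi hj

lemma qnode_leaves_disjoint {n : ℕ} {c : Fin n → PQTree α} (h : (qnode n c).NodupOrders)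
    {i j : Fin n} {x : α} (hi : x ∈ (c i).leaves) (hj : x ∈ (c j).leaves) : i = j := by
  choose f hf using fun i => (c i).orders_nonempty
  exact disjoint_of_nodup_flatten hf (h _ ⟨f, hf, Or.inl rfl⟩) hi hj

lemma filter_flatten_ofFn {n : ℕ} (g : Fin n → List α) (p : α → Bool)
    (i : Fin n) (h : ∀ k x, x ∈ g k → p x → k = i) :
    (List.ofFn g).flatten.filter p = (g i).filter p := by
  rw [List.filter_flatten, List.map_ofFn]
  refine flatten_ofFn_of_forall_ne (fun k => (g k).filter p) i fun k hk => ?_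
  rw [List.filter_eq_nil_iff]
  exact fun x hx hp => hk (h k x hx hp)

open Classical in
/-- The restriction of a represented ordering to the leaves of a subtree is represented by this
subtree. -/
lemma IsNode.filter_mem_orders {s t : PQTree α} (h : IsNode s t) (ht : t.NodupOrders)
    {l : List α} (hl : l ∈ t.orders) : l.filter (· ∈ s.leaves) ∈ s.orders := by
  induction h generalizing l with
  | root =>
    rw [List.filter_eq_self.2]
    · exact hl
    · intro x hx
      simpa using (s.mem_iff_of_mem_orders hl x).1 hx
  | pchild n c i hs ih =>
    obtain ⟨f, σ, hf, rfl⟩ := hl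
    rw [filter_flatten_ofFn _ _ (σ.symm i)]
    · simpa using ih (IsNode.nodupOrders (.pchild n c i .root) ht) (hf i)
    · intro k x hx hp
      rw [(c (σ k)).mem_iff_of_mem_orders (hf _)] at hx
      rw [Equiv.eq_symm_apply]
      exact pnode_leaves_disjoint ht hx (hs.leaves_subset (by simpa using hp))
  | qchild n c i hs ih =>
    have key {m : List α} := ih (IsNode.nodupOrders (.qchild n c i .root) ht) (l := m)
    obtain ⟨f, hf, rfl | rfl⟩ := hl
    · rw [filter_flatten_ofFn _ _ i]
      · exact key (hf i)
      · intro k x hx hp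
        rw [(c k).mem_iff_of_mem_orders (hf _)] at hx
        exact qnode_leaves_disjoint ht hx (hs.leaves_subset (by simpa using hp))
    · rw [filter_flatten_ofFn _ _ i.rev]
      · simpa using key (hf i)
      · intro k x hx hp
        rw [(c k.rev).mem_iff_of_mem_orders (hf _)] at hx
        rw [← Fin.rev_eq_iff]
        exact qnode_leaves_disjoint ht hx (hs.leaves_subset (by simpa using hp))

/-- Every represented ordering lists the subtrees of a Q-node in ascending or in descending
order. -/
lemma IsNode.asc_or_desc {n : ℕ} {c : Fin n → PQTree α} {t : PQTree α}
    (h : IsNode (qnode n c) t) (ht : t.NodupOrders) {l : List α} (hl : l ∈ t.orders) :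
    (∀ i j : Fin n, i < j → ∀ x ∈ (c i).leaves, ∀ y ∈ (c j).leaves, Bef l x y) ∨
    (∀ i j : Fin n, i < j → ∀ x ∈ (c i).leaves, ∀ y ∈ (c j).leaves, Bef l y x) := by
  classical
  have hm := h.filter_mem_orders ht hl
  have hsub : (l.filter (· ∈ (qnode n c).leaves)).Sublist l := List.filter_sublist
  obtain ⟨f, hf, e | e⟩ := hm
  · left
    intro i j hij x hx y hy
    rw [← (c _).mem_iff_of_mem_orders (hf _)] at hx hy
    exact (e ▸ bef_flatten_ofFn f hij hx hy : Bef (l.filter _) x y).mono hsub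
  · right
    intro i j hij x hx y hy
    rw [← (c _).mem_iff_of_mem_orders (hf _)] at hx hy
    refine (e ▸ bef_flatten_ofFn (fun i => f i.rev) (i := j.rev) (j := i.rev) (by simpa using hij)
      (by simpa using hy) (by simpa using hx) : Bef (l.filter _) y x).mono hsub

/-- If some represented ordering places `y` between `x` and `z`, all three from different subtrees
of a Q-node, then so does every represented ordering. -/
lemma IsNode.rigid {n : ℕ} {c : Fin n → PQTree α} {t : PQTree α}
    (h : IsNode (qnode n c) t) (ht : t.NodupOrders) {l l' : List α} (hl : l ∈ t.orders)
    (hl' : l' ∈ t.orders) {i j k : Fin n} (hij : i ≠ j) (hjk : j ≠ k) {x y z : α}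
    (hx : x ∈ (c i).leaves) (hy : y ∈ (c j).leaves) (hz : z ∈ (c k).leaves)
    (hxy : Bef l x y) (hyz : Bef l y z) :
    (Bef l' x y ∧ Bef l' y z) ∨ (Bef l' z y ∧ Bef l' y x) := by
  have hn := ht l hl
  rcases lt_or_gt_of_ne hij with h1 | h1 <;> rcases lt_or_gt_of_ne hjk with h2 | h2 <;>
  rcases h.asc_or_desc ht hl with ha | ha <;>
  rcases h.asc_or_desc ht hl' with hb | hb <;>
  first
    | exact absurd hxy (Bef.asymm hn (ha _ _ h1 _ hx _ hy))
    | exact absurd hxy (Bef.asymm hn (ha _ _ h1 _ hy _ hx))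
    | exact absurd hyz (Bef.asymm hn (ha _ _ h2 _ hy _ hz))
    | exact absurd hyz (Bef.asymm hn (ha _ _ h2 _ hz _ hy))
    | exact Or.inl ⟨hb _ _ h1 _ hx _ hy, hb _ _ h2 _ hy _ hz⟩
    | exact Or.inl ⟨hb _ _ h1 _ hy _ hx, hb _ _ h2 _ hz _ hy⟩
    | exact Or.inr ⟨hb _ _ h2 _ hy _ hz, hb _ _ h1 _ hx _ hy⟩
    | exact Or.inr ⟨hb _ _ h2 _ hz _ hy, hb _ _ h1 _ hy _ hx⟩

end PQTree

/-- Together with `Bef.mono` this transfers the relative order of two elements between two lists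
having a common sublist. -/
lemma Bef.of_mem {α : Type*} {l l₁ : List α} {x y : α} (hl : l.Nodup) (h : Bef l x y)
    (hs : l₁.Sublist l) (hx : x ∈ l₁) (hy : y ∈ l₁) : Bef l₁ x y := by
  rcases Bef.total hx hy (h.ne hl) with h' | h'
  · exact h'
  · exact absurd (h'.mono hs) (h.asymm hl)

/-! ### Induced paths -/

section Paths

variable {V : Type*} {G : SimpleGraph V}

lemma isInducedPath_nil (a : V) : IsInducedPath G (SimpleGraph.Walk.nil : G.Walk a a) := by
  refine ⟨by simp, ?_⟩
  rw [SimpleGraph.Walk.isChordless_iff_forall_mem_edges]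
  intro u v hu hv h
  simp only [SimpleGraph.Walk.support_nil, List.mem_singleton] at hu hv
  subst hu hv
  exact absurd h (G.irrefl)

lemma IsInducedPath.cons {a b c : V} {p : G.Walk b c} (hp : IsInducedPath G p) (h : G.Adj a b)
    (ha : ∀ s ∈ p.support, s ≠ a ∧ (G.Adj a s → s = b)) :
    IsInducedPath G (SimpleGraph.Walk.cons h p) := by
  refine ⟨?_, ?_⟩
  · rw [SimpleGraph.Walk.cons_isPath_iff]
    exact ⟨hp.1, fun h => (ha a h).1 rfl⟩
  · rw [SimpleGraph.Walk.isChordless_iff_forall_mem_edges]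
    intro u v hu hv huv
    simp only [SimpleGraph.Walk.support_cons, List.mem_cons] at hu hv
    simp only [SimpleGraph.Walk.edges_cons, List.mem_cons]
    rcases hu with rfl | hu
    · rcases hv with rfl | hv
      · exact absurd huv G.irrefl
      · left; rw [(ha v hv).2 huv]
    · rcases hv with rfl | hv
      · left; rw [(ha u hu).2 huv.symm, Sym2.eq_swap]
      · right; exact hp.2.mem_edges hu hv huv

lemma IsInducedPath.reverse {a b : V} {p : G.Walk a b} (hp : IsInducedPath G p) :
    IsInducedPath G p.reverse := by
  refine ⟨hp.1.reverse, ?_⟩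
  rw [SimpleGraph.Walk.isChordless_iff_forall_mem_edges]
  intro u v hu hv huv
  simp only [SimpleGraph.Walk.support_reverse, List.mem_reverse] at hu hv
  simpa using hp.2.mem_edges hu hv huv

/-- Minimality ranges over all endpoints satisfying `P`. A repeated vertex, a chord, or an earlier
vertex satisfying `P` would each yield a shorter admissible walk. -/
lemma isInducedPath_of_minimal {D : Set V} {P : V → Prop} {a b : V} (p : G.Walk a b)
    (hD : ∀ s ∈ p.support, s ∈ D) (hb : P b)
    (hmin : ∀ b' (q : G.Walk a b'), (∀ s ∈ q.support, s ∈ D) → P b' → p.length ≤ q.length) :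
    IsInducedPath G p ∧ ∀ s ∈ p.support, s ≠ b → ¬ P s := by
  classical
  induction p with
  | nil =>
    refine ⟨isInducedPath_nil _, fun s hs hne => ?_⟩
    exact absurd (by simpa using hs) hne
  | @cons a c b h p ih =>
    simp only [SimpleGraph.Walk.support_cons, List.mem_cons, forall_eq_or_imp] at hD
    simp only [SimpleGraph.Walk.length_cons] at hmin
    obtain ⟨ih1, ih2⟩ := ih hD.2 hb fun b' q hq hb' => by
      have := hmin b' (.cons h q) (by
        simp only [SimpleGraph.Walk.support_cons, List.mem_cons, forall_eq_or_imp]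
        exact ⟨hD.1, hq⟩) hb'
      simpa using this
    refine ⟨ih1.cons h fun s hs => ⟨?_, fun has => ?_⟩, ?_⟩
    · rintro rfl
      have := hmin b (p.dropUntil s hs)
        (fun r hr => hD.2 r (p.support_dropUntil_subset_support hs hr)) hb
      have := p.length_dropUntil_le_length hs
      omega
    · by_contra hsc
      have h1 := hmin b (.cons has (p.dropUntil s hs)) (by
        simp only [SimpleGraph.Walk.support_cons, List.mem_cons, forall_eq_or_imp]
        exact ⟨hD.1, fun r hr => hD.2 r (p.support_dropUntil_subset_support hs hr)⟩) hb
      have h2 := congrArg SimpleGraph.Walk.length (p.take_spec hs)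
      rw [SimpleGraph.Walk.length_append] at h2
      have h3 : (p.takeUntil s hs).length ≠ 0 := fun h0 =>
        hsc (SimpleGraph.Walk.eq_of_length_eq_zero h0).symm
      simp only [SimpleGraph.Walk.length_cons] at h1
      omega
    · simp only [SimpleGraph.Walk.support_cons, List.mem_cons, forall_eq_or_imp]
      refine ⟨fun _ ha => ?_, ih2⟩
      have := hmin a .nil (by simpa using hD.1) ha
      simp at this

/-- A shortest walk inside `D` to a vertex satisfying `P` is an induced path. -/
lemma exists_isInducedPath {D : Set V} (P : V → Prop) {a b : V} (p : G.Walk a b)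
    (hD : ∀ s ∈ p.support, s ∈ D) (hb : P b) :
    ∃ b', ∃ q : G.Walk a b', P b' ∧ IsInducedPath G q ∧ (∀ s ∈ q.support, s ∈ D) ∧
      ∀ s ∈ q.support, s ≠ b' → ¬ P s := by
  classical
  have hex : ∃ k, ∃ b', ∃ q : G.Walk a b', P b' ∧ (∀ s ∈ q.support, s ∈ D) ∧ q.length = k :=
    ⟨_, b, p, hb, hD, rfl⟩
  obtain ⟨b', q, hb', hq, hk⟩ := Nat.find_spec hex
  have := isInducedPath_of_minimal q hq hb' fun b'' r hr hb'' => by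
    rw [hk]
    exact Nat.find_min' hex ⟨b'', r, hb'', hr, rfl⟩
  exact ⟨b', q, hb', this.1, hq, this.2⟩

end Paths

/-! ### Maximal cliques -/

section Cliques

variable {V : Type*} {G : SimpleGraph V}

lemma exists_maximal_clique_of_adj [Finite V] {a b : V} (h : G.Adj a b) :
    ∃ M, Maximal G.IsClique M ∧ a ∈ M ∧ b ∈ M := by
  have hc : G.IsClique {a, b} := by
    rw [SimpleGraph.isClique_pair]
    exact fun _ => h
  obtain ⟨M, hM, hmax⟩ := (Set.toFinite {s : Set V | G.IsClique s}).exists_le_maximal hc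
  exact ⟨M, hmax, hM (by simp), hM (by simp)⟩

lemma exists_maximal_clique_mem [Finite V] (a : V) : ∃ M, Maximal G.IsClique M ∧ a ∈ M := by
  have hc : G.IsClique {a} := by simp
  obtain ⟨M, hM, hmax⟩ := (Set.toFinite {s : Set V | G.IsClique s}).exists_le_maximal hc
  exact ⟨M, hmax, hM (by simp)⟩

lemma adj_of_mem_maximal {M : Set V} (hM : Maximal G.IsClique M) {a b : V} (ha : a ∈ M)
    (hb : b ∈ M) (hab : a ≠ b) : G.Adj a b :=
  hM.1 ha hb hab

lemma mem_of_forall_adj {M : Set V} (hM : Maximal G.IsClique M) {a : V}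
    (h : ∀ b ∈ M, b ≠ a → G.Adj a b) : a ∈ M := by
  have hc : G.IsClique (insert a M) := by
    rw [SimpleGraph.isClique_insert]
    exact ⟨hM.1, fun b hb hab => h b hb hab.symm⟩
  exact hM.2 hc (Set.subset_insert a M) (Set.mem_insert a M)

lemma exists_not_adj {M : Set V} (hM : Maximal G.IsClique M) {a : V} (ha : a ∉ M) :
    ∃ b ∈ M, b ≠ a ∧ ¬ G.Adj a b := by
  by_contra! h
  exact ha (mem_of_forall_adj hM h)

lemma exists_mem_notMem {M N : Set V} (hM : Maximal G.IsClique M) (hN : Maximal G.IsClique N)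
    (h : M ≠ N) : ∃ a ∈ M, a ∉ N := by
  by_contra! hc
  exact h (hM.eq_of_subset hN.1 hc)

lemma isConsecutiveOrdering_iff {l : List (Set V)} :
    IsConsecutiveOrdering G l ↔ l.Nodup ∧ (∀ K, K ∈ l ↔ Maximal G.IsClique K) ∧
      ∀ (v : V) (A B C : Set V), Bef l A B → Bef l B C → v ∈ A → v ∈ C → v ∈ B := by
  unfold IsConsecutiveOrdering
  refine and_congr_right fun hn => and_congr_right fun _ => ⟨fun h v A B C hAB hBC hA hC => ?_,
    fun h v i j k hij hjk hi hk => ?_⟩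
  · obtain ⟨i, j, hij, rfl, rfl⟩ := Bef.iff_exists_get.1 hAB
    obtain ⟨j', k, hjk, e, rfl⟩ := Bef.iff_exists_get.1 hBC
    obtain rfl := hn.injective_get e
    exact h v i j' k hij.le hjk.le hA hC
  · rcases hij.eq_or_lt with rfl | hij
    · exact hi
    rcases hjk.eq_or_lt with rfl | hjk
    · exact hk
    exact h v _ _ _ (Bef.iff_exists_get.2 ⟨i, j, hij, rfl, rfl⟩)
      (Bef.iff_exists_get.2 ⟨j, k, hjk, rfl, rfl⟩) hi hk

end Cliques

/-! ### Vertices and cliques relative to a subtree of the PQ-tree -/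

namespace IsPQTreeOf

variable {V : Type*} {G : SimpleGraph V} {T s : PQTree (Set V)}

lemma consecutive (hT : IsPQTreeOf G T) {l : List (Set V)} (hl : l ∈ T.orders) {v : V}
    {A B C : Set V} (hAB : Bef l A B) (hBC : Bef l B C) (hA : v ∈ A) (hC : v ∈ C) : v ∈ B :=
  (isConsecutiveOrdering_iff.1 ((hT.2 l).1 hl)).2.2 v A B C hAB hBC hA hC

lemma nodupOrders (hT : IsPQTreeOf G T) : T.NodupOrders := fun l hl => ((hT.2 l).1 hl).1

lemma mem_order_iff (hT : IsPQTreeOf G T) {l : List (Set V)} (hl : l ∈ T.orders) {K : Set V} :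
    K ∈ l ↔ Maximal G.IsClique K := ((hT.2 l).1 hl).2.1 K

lemma mem_leaves_iff (hT : IsPQTreeOf G T) {K : Set V} :
    K ∈ T.leaves ↔ Maximal G.IsClique K := by
  obtain ⟨l, hl⟩ := T.orders_nonempty
  rw [← T.mem_iff_of_mem_orders hl, hT.mem_order_iff hl]

lemma maximal_of_mem (hT : IsPQTreeOf G T) (hs : PQTree.IsNode s T) {K : Set V}
    (hK : K ∈ s.leaves) : Maximal G.IsClique K :=
  hT.mem_leaves_iff.1 (hs.leaves_subset hK)

/-- A vertex which belongs to a clique of a subtree and to a clique outside this subtree belongs to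
all cliques of the subtree. -/
lemma mem_of_mem_of_mem (hT : IsPQTreeOf G T) (hs : PQTree.IsNode s T) {v : V} {M N M' : Set V}
    (hM : M ∈ s.leaves) (hN : Maximal G.IsClique N) (hNs : N ∉ s.leaves) (hvM : v ∈ M)
    (hvN : v ∈ N) (hM' : M' ∈ s.leaves) : v ∈ M' := by
  obtain ⟨l₁, l₂, h⟩ := hs.context
  obtain ⟨m, hm⟩ := s.orders_nonempty
  have h1 := h m hm
  -- Reversing only the subtree leaves `N` on its side, so in one of the two orderings `M'` lies
  -- between `M` and `N`.
  have h2 := h _ (s.reverse_mem_orders hm)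
  rw [← s.mem_iff_of_mem_orders hm] at hM hM' hNs
  have hN' := (hT.mem_order_iff h1).2 hN
  by_cases hne : M = M'
  · exact hne ▸ hvM
  simp only [List.mem_append] at hN'
  rcases Bef.total hM hM' hne with hb | hb <;> rcases hN' with (hN' | hN') | hN'
  · exact hT.consecutive h2 (by simp [Bef.append_iff, hN', hM'])
      (by simp [Bef.append_iff, Bef.reverse_iff, hb]) hvN hvM
  · exact absurd hN' hNs
  · exact hT.consecutive h1 (by simp [Bef.append_iff, hb]) (by simp [Bef.append_iff, hN', hM'])
      hvM hvN
  · exact hT.consecutive h1 (by simp [Bef.append_iff, hN', hM'])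
      (by simp [Bef.append_iff, hb]) hvN hvM
  · exact absurd hN' hNs
  · exact hT.consecutive h2 (by simp [Bef.append_iff, Bef.reverse_iff, hb])
      (by simp [Bef.append_iff, hN', hM']) hvM hvN

/-- The leaves of the subtree can be taken as one contiguous block, so `M` lies wholly on one side
of it; if it lies behind, the ordering is reversed. -/
lemma exists_order_bef (hT : IsPQTreeOf G T) (hs : PQTree.IsNode s T) {M : Set V}
    (hM : Maximal G.IsClique M) (hMs : M ∉ s.leaves) :
    ∃ l ∈ T.orders, ∀ L ∈ s.leaves, Bef l M L := by
  obtain ⟨l₁, l₂, h⟩ := hs.context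
  obtain ⟨m, hm⟩ := s.orders_nonempty
  have hM' := (hT.mem_order_iff (h m hm)).2 hM
  rw [← s.mem_iff_of_mem_orders hm] at hMs
  simp only [List.mem_append, hMs, or_false] at hM'
  rcases hM' with hM' | hM'
  · refine ⟨_, h m hm, fun L hL => ?_⟩
    rw [← s.mem_iff_of_mem_orders hm] at hL
    simp [Bef.append_iff, hL, hM']
  · refine ⟨_, T.reverse_mem_orders (h m hm), fun L hL => ?_⟩
    rw [← s.mem_iff_of_mem_orders hm] at hL
    simp [Bef.reverse_iff, Bef.append_iff, hL, hM']

/-- A clique `M` preceding some other one contains a vertex which is separated from everything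
that comes after `M`. -/
lemma exists_separated [Finite V] (hT : IsPQTreeOf G T) {l : List (Set V)} (hl : l ∈ T.orders)
    {M L : Set V} (hML : Bef l M L) :
    ∃ y ∈ M, (∀ N, Bef l M N → y ∉ N) ∧ ∀ (x w : V) (p : G.Walk x w),
      (∀ s ∈ p.support, s ∉ M) → (∃ N, Bef l M N ∧ x ∈ N) →
        ∀ s ∈ p.support, s ≠ y ∧ ¬ G.Adj s y := by
  have hn := hT.nodupOrders l hl
  have hM := (hT.mem_order_iff hl).1 hML.mem_left
  -- A vertex of `M` missing from the immediate successor of `M` is missing from all later cliques,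
  -- by consecutiveness.
  obtain ⟨y, hyM, hy⟩ : ∃ y ∈ M, ∀ N, Bef l M N → y ∉ N := by
    obtain ⟨a, b, rfl⟩ := List.append_of_mem hML.mem_left
    have hb : ∀ N, Bef (a ++ M :: b) M N → N ∈ b := by
      intro N h
      rw [Bef.append_iff, Bef.cons_iff] at h
      have hn' := List.nodup_append.1 hn
      have hn2 := List.nodup_cons.1 hn'.2.1
      rcases h with h | (⟨-, h⟩ | h) | ⟨h, -⟩
      · exact absurd rfl (hn'.2.2 M h.mem_left M (by simp))
      · exact h
      · exact h.mem_right
      · exact absurd rfl (hn'.2.2 M h M (by simp))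
    cases b with
    | nil => exact absurd (hb L hML) (by simp)
    | cons M' b =>
      have hMM' : Bef (a ++ M :: M' :: b) M M' := by simp [Bef.append_iff, Bef.cons_iff]
      obtain ⟨y, hyM, hyM'⟩ := exists_mem_notMem hM
        ((hT.mem_order_iff hl).1 hMM'.mem_right) (hMM'.ne hn)
      refine ⟨y, hyM, fun N hN hyN => hyM' ?_⟩
      rcases List.mem_cons.1 (hb N hN) with rfl | hN'
      · exact hyN
      · exact hT.consecutive hl hMM' (by simp [Bef.append_iff, Bef.cons_iff, hN']) hyM hyN
  -- A walk that avoids `M` and starts behind `M` stays behind it: cliques of one vertex cannot lie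
  -- on both sides of `M`, and adjacent vertices share a clique.
  have side : ∀ (x w : V) (p : G.Walk x w), (∀ s ∈ p.support, s ∉ M) →
      (∃ N, Bef l M N ∧ x ∈ N) → ∀ s ∈ p.support, ∀ N, Maximal G.IsClique N → s ∈ N →
        Bef l M N := by
    have one : ∀ x ∉ M, (∃ N, Bef l M N ∧ x ∈ N) → ∀ N, Maximal G.IsClique N → x ∈ N →
        Bef l M N := by
      rintro x hx ⟨N, hN, hxN⟩ N' hN' hxN'
      have hne : M ≠ N' := by rintro rfl; exact hx hxN'
      rcases Bef.total hN.mem_left ((hT.mem_order_iff hl).2 hN') hne with h | h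
      · exact h
      · exact absurd (hT.consecutive hl h hN hxN' hxN) hx
    intro x w p
    induction p with
    | nil =>
      intro hM h s hs
      simp only [SimpleGraph.Walk.support_nil, List.mem_singleton] at hs
      subst hs
      exact one s (hM s (by simp)) h
    | cons h p ih =>
      intro hM hx s hs
      simp only [SimpleGraph.Walk.support_cons, List.mem_cons, forall_eq_or_imp] at hM hs
      have hx' := one _ hM.1 hx
      rcases hs with rfl | hs
      · exact hx'
      · obtain ⟨N, hN, h1, h2⟩ := exists_maximal_clique_of_adj h
        exact ih hM.2 ⟨N, hx' N hN h1, h2⟩ s hs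
  refine ⟨y, hyM, hy, fun x w p hp hx s hs => ⟨?_, fun hadj => ?_⟩⟩
  · rintro rfl
    exact hp s hs hyM
  · obtain ⟨N, hN, h1, h2⟩ := exists_maximal_clique_of_adj hadj
    exact hy N (side x w p hp hx s hs N hN h1) h2

end IsPQTreeOf

/-! ### Rigidity of Q-nodes forces a non-neighbour of a universal vertex -/

namespace IsPQTreeOf

variable {V : Type*} {G : SimpleGraph V} {T : PQTree (Set V)}

/-- Otherwise every universal vertex (set `U`) is adjacent to the whole component `C` of `y` among
the vertices missing `c j`. A maximal clique meeting `C` then contains `U` and lies inside `C ∪ U`.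
Gathering these cliques into a block directly behind `c j` keeps the ordering consecutive but
carries `K` to the other side of `c j`, and a third subtree shows that this is not an order of the
Q-node. -/
lemma exists_nonadjacent_of_mem_left (hT : IsPQTreeOf G T) {n : ℕ}
    {c : Fin n → PQTree (Set V)} (hQ : PQTree.IsNode (PQTree.qnode n c) T) {i j : Fin n}
    (hij : i ≠ j) {l₁ m l₂ : List (Set V)} (hl : l₁ ++ m ++ l₂ ∈ T.orders)
    (hm : ∀ L, L ∈ m ↔ L ∈ (c j).leaves) {K : Set V} (hK : K ∈ (c i).leaves) (hK₁ : K ∈ l₁)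
    {y : V} (hy : y ∈ K) (hyD : ∀ L ∈ (c j).leaves, y ∉ L) :
    ∃ t w, ∃ p : G.Walk y w, (∀ s ∈ p.support, ∀ L ∈ (c j).leaves, s ∉ L) ∧
      (∀ L ∈ (c j).leaves, t ∈ L) ∧ ¬ G.Adj t w := by
  classical
  by_contra! hcon
  set C : Set V := {w | ∃ p : G.Walk y w, ∀ s ∈ p.support, ∀ L ∈ (c j).leaves, s ∉ L} with hC
  set U : Set V := {t | ∀ L ∈ (c j).leaves, t ∈ L} with hU
  have hUC : ∀ t ∈ U, ∀ w ∈ C, G.Adj t w := by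
    rintro t ht w ⟨p, hp⟩
    exact hcon t w p hp ht
  have hyC : y ∈ C := ⟨.nil, by simpa using hyD⟩
  have hCD : ∀ w ∈ C, ∀ L ∈ (c j).leaves, w ∉ L := fun w ⟨p, hp⟩ => hp w (by simp)
  have hCadj : ∀ w ∈ C, ∀ s, G.Adj w s → (∀ L ∈ (c j).leaves, s ∉ L) → s ∈ C := by
    rintro w ⟨p, hp⟩ s hws hs
    refine ⟨p.concat hws, fun r hr => ?_⟩
    rw [SimpleGraph.Walk.support_concat, List.mem_append,
      List.mem_singleton] at hr
    rcases hr with hr | rfl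
    · exact hp r hr
    · exact hs
  have hj : PQTree.IsNode (c j) T := (PQTree.IsNode.qchild n c j .root).trans hQ
  have hi : PQTree.IsNode (c i) T := (PQTree.IsNode.qchild n c i .root).trans hQ
  have hQn := hQ.nodupOrders hT.nodupOrders
  have hdisj {a b : Fin n} {M : Set V} (ha : M ∈ (c a).leaves) (hb : M ∈ (c b).leaves) : a = b :=
    PQTree.qnode_leaves_disjoint hQn ha hb
  set X : Set (Set V) := {M | ∃ w ∈ C, w ∈ M} with hX
  have hKX : K ∈ X := ⟨y, hyC, hy⟩
  have hXj : ∀ M ∈ X, M ∉ (c j).leaves := fun M ⟨w, hw, hwM⟩ h => hCD w hw M h hwM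
  have hXsub : ∀ M ∈ X, Maximal G.IsClique M → ∀ v ∈ M, v ∈ C ∨ v ∈ U := by
    rintro M hMX hM v hv
    obtain ⟨w, hw, hwM⟩ := id hMX
    by_cases hvD : ∀ L ∈ (c j).leaves, v ∉ L
    · left
      by_cases hvw : w = v
      · exact hvw ▸ hw
      · exact hCadj w hw v (adj_of_mem_maximal hM hwM hv hvw) hvD
    · right
      push Not at hvD
      obtain ⟨L, hL, hvL⟩ := hvD
      exact fun L' hL' => hT.mem_of_mem_of_mem hj hL hM (hXj M hMX) hvL hv hL'
  obtain ⟨L, hL⟩ := PQTree.leaves_nonempty (hj.wellFormed hT.1)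
  have hUX : ∀ M ∈ X, Maximal G.IsClique M → ∀ t ∈ U, t ∈ M := by
    intro M hMX hM t ht
    refine mem_of_forall_adj hM fun b hb hbt => ?_
    rcases hXsub M hMX hM b hb with hbC | hbU
    · exact hUC t ht b hbC
    · exact adj_of_mem_maximal (hT.maximal_of_mem hj hL) (ht L hL) (hbU L hL) hbt.symm
  have hn := hT.nodupOrders _ hl
  -- the cliques meeting `C` are moved right behind the subtree
  set a := l₁.filter (· ∈ X) with ha
  set a' := l₁.filter (· ∉ X) with ha'
  set b := l₂.filter (· ∈ X) with hb
  set b' := l₂.filter (· ∉ X) with hb'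
  have hperm : (a' ++ (m ++ ((a ++ b) ++ b'))).Perm (l₁ ++ m ++ l₂) := by
    have h1 : (a ++ a').Perm l₁ := by
      simpa [ha, ha'] using List.filter_append_perm (fun M => decide (M ∈ X)) l₁
    have h2 : (b ++ b').Perm l₂ := by
      simpa [hb, hb'] using List.filter_append_perm (fun M => decide (M ∈ X)) l₂
    refine List.Perm.trans ?_ ((h1.append_right m).append h2)
    rw [List.perm_iff_count]
    intro x
    simp only [List.count_append]
    omega
  set l' := a' ++ (m ++ ((a ++ b) ++ b')) with hl'
  have hn' : l'.Nodup := hperm.nodup_iff.2 hn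
  have hmem' : ∀ M, M ∈ l' ↔ M ∈ l₁ ++ m ++ l₂ := fun M => hperm.mem_iff
  have hmaxl : ∀ M, M ∈ l' ↔ Maximal G.IsClique M := fun M =>
    (hmem' M).trans (hT.mem_order_iff hl)
  have has : a.Sublist l₁ := List.filter_sublist
  have has' : a'.Sublist l₁ := List.filter_sublist
  have hbs : b.Sublist l₂ := List.filter_sublist
  have hbs' : b'.Sublist l₂ := List.filter_sublist
  have hmX : ∀ M ∈ m, M ∉ X := fun M hM hMX => hXj M hMX ((hm M).1 hM)
  have habX : ∀ M ∈ a ++ b, M ∈ X := by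
    intro M hM
    simp only [ha, hb, List.mem_append, List.mem_filter, decide_eq_true_eq] at hM
    tauto
  have ha'X : ∀ M ∈ a', M ∉ X := by
    intro M hM
    simp only [ha', List.mem_filter, decide_eq_true_eq] at hM
    exact hM.2
  have hb'X : ∀ M ∈ b', M ∉ X := by
    intro M hM
    simp only [hb', List.mem_filter, decide_eq_true_eq] at hM
    exact hM.2
  have hinX : ∀ M ∈ l', M ∈ X → M ∈ a ++ b := by
    intro M hM hMX
    simp only [hl', List.mem_append] at hM ⊢
    rcases hM with hM | hM | hM | hM
    · exact absurd hMX (ha'X M hM)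
    · exact absurd hMX (hmX M hM)
    · exact hM
    · exact absurd hMX (hb'X M hM)
  have hinX' : ∀ M ∈ l', M ∉ X → M ∈ a' ∨ M ∈ m ∨ M ∈ b' := by
    intro M hM hMX
    simp only [hl', List.mem_append] at hM
    rcases hM with hM | hM | hM | hM
    · exact Or.inl hM
    · exact Or.inr (Or.inl hM)
    · exact absurd (habX M (by simpa using hM)) hMX
    · exact Or.inr (Or.inr hM)
  have hB₁ : ∀ x ∈ a', ∀ y, y ∈ m ∨ y ∈ a ++ b ∨ y ∈ b' → Bef l' x y := fun x hx y hy =>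
    Bef.append_iff.2 (Or.inr (Or.inr ⟨hx, by simpa only [List.mem_append] using hy⟩))
  have hB₂ : ∀ x ∈ m, ∀ y, y ∈ a ++ b ∨ y ∈ b' → Bef l' x y := fun x hx y hy =>
    Bef.append_iff.2 (Or.inr (Or.inl (Bef.append_iff.2 (Or.inr (Or.inr
      ⟨hx, by simpa only [List.mem_append] using hy⟩)))))
  have hB₃ : ∀ x ∈ a ++ b, ∀ y ∈ b', Bef l' x y := fun x hx y hy =>
    Bef.append_iff.2 (Or.inr (Or.inl (Bef.append_iff.2 (Or.inr (Or.inl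
      (Bef.append_iff.2 (Or.inr (Or.inr ⟨hx, hy⟩))))))))
  have hmem₄ : ∀ M ∈ l', M ∈ a' ∨ M ∈ m ∨ M ∈ a ++ b ∨ M ∈ b' := fun M hM => by
    simpa only [hl', List.mem_append] using hM
  have hsubX : (a ++ b).Sublist l' := by
    refine List.Sublist.trans ?_ (List.sublist_append_right _ _)
    exact (List.sublist_append_left _ _).trans (List.sublist_append_right _ _)
  have hsubX' : (a' ++ (m ++ b')).Sublist l' :=
    (List.Sublist.refl _).append ((List.Sublist.refl _).append (List.sublist_append_right _ _))
  have hsubXl : (a ++ b).Sublist (l₁ ++ m ++ l₂) :=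
    (has.trans (List.sublist_append_left _ _)).append hbs
  have hsubXl' : (a' ++ (m ++ b')).Sublist (l₁ ++ m ++ l₂) := by
    rw [List.append_assoc]
    exact has'.append ((List.Sublist.refl _).append hbs')
  have hcons : IsConsecutiveOrdering G l' := by
    rw [isConsecutiveOrdering_iff]
    refine ⟨hn', hmaxl, fun v A B D hAB hBD hvA hvD => ?_⟩
    have hAl := hAB.mem_left
    have hBl := hAB.mem_right
    have hDl := hBD.mem_right
    have nBA := hAB.asymm hn'
    have nDB := hBD.asymm hn'
    -- Vertices of `C` occur only in the moved block. Vertices of `U` fill the block and the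
    -- subtree, so only `B` outside both needs the old ordering. Any other vertex misses the block;
    -- if it occurred on both sides of the block, it would lie in all of `c j` and so in `U`.
    by_cases hvC : v ∈ C
    · have hA := hinX A hAl ⟨v, hvC, hvA⟩
      have hD := hinX D hDl ⟨v, hvC, hvD⟩
      by_cases hBX : B ∈ X
      · have hB := hinX B hBl hBX
        exact hT.consecutive hl ((hAB.of_mem hn' hsubX hA hB).mono hsubXl)
          ((hBD.of_mem hn' hsubX hB hD).mono hsubXl) hvA hvD
      · exfalso
        rcases hinX' B hBl hBX with hB | hB | hB
        · exact nBA (hB₁ B hB A (Or.inr (Or.inl hA)))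
        · exact nBA (hB₂ B hB A (Or.inl hA))
        · exact nDB (hB₃ D hD B hB)
    by_cases hvU : v ∈ U
    · by_cases hBX : B ∈ X
      · exact hUX B hBX ((hmaxl B).1 hBl) v hvU
      rcases hinX' B hBl hBX with hB | hB | hB
      · have hA : A ∈ a' := by
          by_contra hA
          exact nBA (hB₁ B hB A ((hmem₄ A hAl).resolve_left hA))
        refine hT.consecutive hl (C := L) ((hAB.of_mem hn' ?_ hA hB).mono ?_) ?_ hvA (hvU L hL)
        · exact List.sublist_append_left _ _
        · exact has'.trans (by simp)
        · simp [Bef.append_iff, has'.subset hB, (hm L).2 hL]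
      · exact hvU B ((hm B).1 hB)
      · have hD : D ∈ b' := by
          by_contra hD
          rcases hmem₄ D hDl with h | h | h | h
          · exact nDB (hB₁ D h B (Or.inr (Or.inr hB)))
          · exact nDB (hB₂ D h B (Or.inr hB))
          · exact nDB (hB₃ D h B hB)
          · exact hD h
        refine hT.consecutive hl (A := L) ?_ ((hBD.of_mem hn' ?_ hB hD).mono ?_) (hvU L hL) hvD
        · simp [Bef.append_iff, hbs'.subset hB, (hm L).2 hL]
        · exact ((List.sublist_append_right _ _).trans (List.sublist_append_right _ _)).trans
            (List.sublist_append_right _ _)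
        · exact hbs'.trans (by simp)
    have hnX : ∀ M ∈ l', v ∈ M → M ∉ X := fun M hM hvM hMX => by
      rcases hXsub M hMX ((hmaxl M).1 hM) v hvM with h | h <;> tauto
    have hA := hinX' A hAl (hnX A hAl hvA)
    have hD := hinX' D hDl (hnX D hDl hvD)
    by_cases hBX : B ∈ X
    · exfalso
      have hB := hinX B hBl hBX
      have hD' : D ∈ b' := by
        rcases hD with h | h | h
        · exact absurd (hB₁ D h B (Or.inr (Or.inl hB))) nDB
        · exact absurd (hB₂ D h B (Or.inl hB)) nDB
        · exact h
      have hA' : A ∈ a' ∨ A ∈ m := by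
        rcases hA with h | h | h
        · exact Or.inl h
        · exact Or.inr h
        · exact absurd (hB₃ B hB A h) nBA
      have hD2 := hbs'.subset hD'
      rcases hA' with hA' | hA'
      · refine hvU fun L' hL' => hT.consecutive hl (A := A) (C := D) ?_ ?_ hvA hvD
        · simp [Bef.append_iff, has'.subset hA', (hm L').2 hL']
        · simp [Bef.append_iff, hD2, (hm L').2 hL']
      · refine hvU fun L' hL' => hT.mem_of_mem_of_mem hj ((hm A).1 hA') ((hmaxl D).1 hDl)
          (fun h => ?_) hvA hvD hL'
        have hDm := (hm D).2 h
        exact Bef.ne hn (x := D) (y := D) (by simp [Bef.append_iff, hD2, hDm]) rfl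
    · have hB := hinX' B hBl hBX
      have hA2 : A ∈ a' ++ (m ++ b') := by simpa using hA
      have hB2 : B ∈ a' ++ (m ++ b') := by simpa using hB
      have hD2 : D ∈ a' ++ (m ++ b') := by simpa using hD
      exact hT.consecutive hl ((hAB.of_mem hn' hsubX' hA2 hB2).mono hsubXl')
        ((hBD.of_mem hn' hsubX' hB2 hD2).mono hsubXl') hvA hvD
  have hlT : l' ∈ T.orders := (hT.2 l').2 hcons
  -- A third child is essential: for two children, moving one past the other is merely a reversal.
  have hn3 : 3 ≤ n := (hQ.wellFormed hT.1).1
  obtain ⟨k, hki, hkj⟩ : ∃ k : Fin n, k ≠ i ∧ k ≠ j := by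
    have : ({i, j} : Finset (Fin n)).card < (Finset.univ : Finset (Fin n)).card := by
      have := Finset.card_le_two (a := i) (b := j)
      simp only [Finset.card_univ, Fintype.card_fin]
      omega
    obtain ⟨k, -, hk⟩ := Finset.exists_mem_notMem_of_card_lt_card this
    simp only [Finset.mem_insert, Finset.mem_singleton, not_or] at hk
    exact ⟨k, hk⟩
  have hk : PQTree.IsNode (c k) T := (PQTree.IsNode.qchild n c k .root).trans hQ
  obtain ⟨M, hM⟩ := PQTree.leaves_nonempty (hk.wellFormed hT.1)
  have hLm : L ∈ m := (hm L).2 hL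
  have hMm : M ∉ m := fun h => hkj (hdisj hM ((hm M).1 h))
  have hMl : M ∈ l₁ ++ m ++ l₂ := (hT.mem_order_iff hl).2 (hT.maximal_of_mem hk hM)
  have hMl' := (hmem' M).2 hMl
  have hKab : K ∈ a ++ b := hinX K ((hmaxl K).2 (hT.maximal_of_mem hi hK)) hKX
  have hKL : Bef (l₁ ++ m ++ l₂) K L := by simp [Bef.append_iff, hK₁, hLm]
  have hLK' : Bef l' L K := hB₂ L hLm K (Or.inl hKab)
  have hnKL' := hLK'.asymm hn'
  have hKM : K ≠ M := fun h => hki (hdisj hM (h ▸ hK))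
  simp only [List.mem_append, hMm, or_false] at hMl
  -- In each case a different one of `K`, `L`, `M` is in the middle before and after the move,
  -- against `IsNode.rigid`.
  rcases hMl with hM₁ | hM₂
  · have hML : Bef (l₁ ++ m ++ l₂) M L := by simp [Bef.append_iff, hM₁, hLm]
    by_cases hMX : M ∈ X
    · have hMab := hinX M hMl' hMX
      rcases Bef.total (l := l₁ ++ m ++ l₂) (x := K) (y := M) (by simp [hK₁]) (by simp [hM₁]) hKM
        with h | h
      · have h' := (h.of_mem hn hsubXl hKab hMab).mono hsubX
        rcases hQ.rigid hT.nodupOrders hl hlT hki.symm hkj hK hM hL h hML with h2 | h2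
        · exact hnKL' (h2.1.trans hn' h2.2)
        · exact h'.asymm hn' h2.2
      · have h' := (h.of_mem hn hsubXl hMab hKab).mono hsubX
        rcases hQ.rigid hT.nodupOrders hl hlT hki hij hM hK hL h hKL with h2 | h2
        · exact hnKL' h2.2
        · exact h'.asymm hn' h2.2
    · have hMa : M ∈ a' := by
        simp only [ha', List.mem_filter, decide_eq_true_eq]
        exact ⟨hM₁, hMX⟩
      have hML' : Bef l' M L := hB₁ M hMa L (Or.inl hLm)
      have hMK' := hML'.trans hn' hLK'
      rcases Bef.total (l := l₁ ++ m ++ l₂) (x := K) (y := M) (by simp [hK₁]) (by simp [hM₁]) hKM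
        with h | h
      · rcases hQ.rigid hT.nodupOrders hl hlT hki.symm hkj hK hM hL h hML with h2 | h2
        · exact hMK'.asymm hn' h2.1
        · exact hML'.asymm hn' h2.1
      · rcases hQ.rigid hT.nodupOrders hl hlT hki hij hM hK hL h hKL with h2 | h2
        · exact hnKL' h2.2
        · exact hMK'.asymm hn' h2.2
  · have hLM : Bef (l₁ ++ m ++ l₂) L M := by simp [Bef.append_iff, hM₂, hLm]
    have hLM' : Bef l' L M := by
      refine hB₂ L hLm M ?_
      by_cases hMX : M ∈ X
      · exact Or.inl (hinX M hMl' hMX)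
      · right
        simp only [hb', List.mem_filter, decide_eq_true_eq]
        exact ⟨hM₂, hMX⟩
    rcases hQ.rigid hT.nodupOrders hl hlT hij hkj.symm hK hL hM hKL hLM with h2 | h2
    · exact hnKL' h2.1
    · exact hLM'.asymm hn' h2.1

/-- Let `y` lie in a clique of one subtree of a Q-node, but in no clique of another subtree. Then
without touching the latter one can walk from `y` to a non-neighbour of some vertex contained in all
cliques of the latter. -/
lemma exists_nonadjacent [Finite V] (hT : IsPQTreeOf G T) {n : ℕ}
    {c : Fin n → PQTree (Set V)} (hQ : PQTree.IsNode (PQTree.qnode n c) T) {i j : Fin n}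
    (hij : i ≠ j) {K : Set V} (hK : K ∈ (c i).leaves)
    {y : V} (hy : y ∈ K) (hyD : ∀ L ∈ (c j).leaves, y ∉ L) :
    ∃ t w, ∃ p : G.Walk y w, (∀ s ∈ p.support, ∀ L ∈ (c j).leaves, s ∉ L) ∧
      (∀ L ∈ (c j).leaves, t ∈ L) ∧ ¬ G.Adj t w := by
  have hj : PQTree.IsNode (c j) T := (PQTree.IsNode.qchild n c j .root).trans hQ
  have hi : PQTree.IsNode (c i) T := (PQTree.IsNode.qchild n c i .root).trans hQ
  obtain ⟨l₁, l₂, h⟩ := hj.context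
  obtain ⟨m, hm⟩ := (c j).orders_nonempty
  have hm' := fun L => (c j).mem_iff_of_mem_orders hm L
  have hKm : K ∉ m := fun h => hij
    (PQTree.qnode_leaves_disjoint (hQ.nodupOrders hT.nodupOrders) hK ((hm' K).1 h))
  have hl := h m hm
  have hKl := (hT.mem_order_iff hl).2 (hT.maximal_of_mem hi hK)
  simp only [List.mem_append, hKm, or_false] at hKl
  rcases hKl with hKl | hKl
  · exact hT.exists_nonadjacent_of_mem_left hQ hij hl hm' hK hKl hy hyD
  · have hl' := T.reverse_mem_orders hl
    simp only [List.reverse_append, ← List.append_assoc] at hl'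
    exact hT.exists_nonadjacent_of_mem_left hQ hij hl' (by simpa using hm') hK (by simpa using hKl)
      hy hyD

end IsPQTreeOf

/-! ### Geometry of the pre-drawn intervals and of the regions -/

namespace PartialRep

variable {V : Type*} {G : SimpleGraph V} (R : PartialRep G)

lemma adj_of_mem_interval {u v : V} (hu : u ∈ R.dom) (hv : v ∈ R.dom) (huv : u ≠ v) {t : ℝ}
    (htu : t ∈ R.interval u) (htv : t ∈ R.interval v) : G.Adj u v :=
  (R.adj_iff u hu v hv huv).2 ⟨t, htu, htv⟩

lemma left_le_right_of_adj_or_eq {u v : V} (hu : u ∈ R.dom) (hv : v ∈ R.dom)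
    (huv : u = v ∨ G.Adj u v) : R.left v ≤ R.right u := by
  rcases huv with rfl | huv
  · exact R.left_le_right u hu
  · obtain ⟨t, ht, ht'⟩ := (R.adj_iff u hu v hv huv.ne).1 huv
    exact ht'.1.trans ht.2

lemma leftOf_of_not_adj {u v : V} (hu : u ∈ R.dom) (hv : v ∈ R.dom) (huv : u ≠ v)
    (h : ¬ G.Adj u v) {a b : ℝ} (ha : a ∈ R.interval u) (hb : b ∈ R.interval v) (hab : a ≤ b) :
    R.LeftOf u v := by
  by_contra hlt
  have hlt : R.left v ≤ R.right u := not_lt.1 hlt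
  refine h (R.adj_of_mem_interval hu hv huv (t := max a (R.left v)) ⟨?_, ?_⟩ ⟨?_, ?_⟩)
  · exact ha.1.trans (le_max_left _ _)
  · exact max_le ha.2 hlt
  · exact le_max_right _ _
  · exact max_le (hab.trans hb.2) (hb.1.trans hb.2)

lemma mem_interval_of_mem_of_mem {v : V} {a b t : ℝ} (ha : a ∈ R.interval v)
    (hb : b ∈ R.interval v) (hat : a ≤ t) (htb : t ≤ b) : t ∈ R.interval v :=
  ⟨ha.1.trans hat, htb.trans hb.2⟩

/-- Two intervals meeting a connected set of points that is covered by intervals of vertices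
outside `M` are joined by a walk through such vertices. -/
lemma exists_walk_of_cover [Finite V] {M : Set V} {I : Set ℝ} (hI : IsPreconnected I)
    (hcov : ∀ t ∈ I, ∃ v ∈ R.dom, v ∉ M ∧ t ∈ R.interval v) {x z : V}
    (hx : x ∈ R.dom) (hxM : x ∉ M) (hxI : (I ∩ R.interval x).Nonempty)
    (hz : z ∈ R.dom) (hzM : z ∉ M) (hzI : (I ∩ R.interval z).Nonempty) :
    ∃ p : G.Walk x z, ∀ s ∈ p.support, s ∈ R.dom ∧ s ∉ M ∧ (I ∩ R.interval s).Nonempty := by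
  set E : Set V := {s | s ∈ R.dom ∧ s ∉ M ∧ (I ∩ R.interval s).Nonempty} with hE
  set C : Set V := {s | ∃ p : G.Walk x s, ∀ r ∈ p.support, r ∈ E} with hC
  change z ∈ C
  by_contra hzC
  have hxC : x ∈ C := ⟨.nil, by simpa using ⟨hx, hxM, hxI⟩⟩
  have hclosed : ∀ A : Set V, IsClosed (⋃ s ∈ A, R.interval s) := fun A =>
    (Set.toFinite A).isClosed_biUnion fun s _ => isClosed_Icc
  -- The intervals of reached and of unreached vertices form two finite, hence closed, unions
  -- covering the connected set `I`. They share a point of `I`, where a reached and an unreached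
  -- interval intersect.
  obtain ⟨t, htI, htA, htB⟩ := isPreconnected_closed_iff.1 hI (⋃ s ∈ C, R.interval s)
    (⋃ s ∈ E \ C, R.interval s) (hclosed _) (hclosed _) (by
      intro t ht
      obtain ⟨v, hv, hvM, hvt⟩ := hcov t ht
      by_cases hvC : v ∈ C
      · exact Or.inl (Set.mem_biUnion hvC hvt)
      · exact Or.inr (Set.mem_biUnion ⟨⟨hv, hvM, t, ht, hvt⟩, hvC⟩ hvt))
    (by
      obtain ⟨t, ht, ht'⟩ := hxI
      exact ⟨t, ht, Set.mem_biUnion hxC ht'⟩)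
    (by
      obtain ⟨t, ht, ht'⟩ := hzI
      exact ⟨t, ht, Set.mem_biUnion ⟨⟨hz, hzM, t, ht, ht'⟩, hzC⟩ ht'⟩)
  simp only [Set.mem_iUnion] at htA htB
  obtain ⟨s, ⟨p, hp⟩, hst⟩ := htA
  obtain ⟨s', ⟨hs'E, hs'C⟩, hst'⟩ := htB
  have hne : s ≠ s' := by rintro rfl; exact hs'C ⟨p, hp⟩
  have hadj := R.adj_of_mem_interval (hp s (by simp)).1 hs'E.1 hne hst hst'
  refine hs'C ⟨p.concat hadj, fun r hr => ?_⟩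
  rw [SimpleGraph.Walk.support_concat, List.mem_append, List.mem_singleton] at hr
  rcases hr with hr | rfl
  · exact hp r hr
  · exact hs'E

lemma exists_covering_of_notMem_region {M : Set V} {t : ℝ} (ht : t ∉ R.region M)
    (hM : ∀ v ∈ R.dom, v ∈ M → t ∈ R.interval v) :
    ∃ v ∈ R.dom, v ∉ M ∧ t ∈ R.interval v := by
  by_contra! h
  exact ht fun v hv => ⟨fun hvt => by_contra fun hvM => h v hv hvM hvt, hM v hv⟩

/-- Such points lie in the region of any clique without pre-drawn vertices. -/
lemma exists_lt_uncovered [Finite V] (a : ℝ) : ∃ t < a, ∀ v, t ∉ R.interval v := by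
  obtain ⟨b, hb⟩ := (Set.finite_range R.left).bddBelow
  refine ⟨min a b - 1, by linarith [min_le_left a b], fun v hv => ?_⟩
  have := hb ⟨v, rfl⟩
  linarith [min_le_right a b, hv.1]

/-- The two pre-drawn vertices which bound the intersection of all pre-drawn intervals of a
clique. -/
lemma exists_extremal [Finite V] {M : Set V} (hM : Maximal G.IsClique M)
    (hne : ∃ v ∈ R.dom, v ∈ M) :
    ∃ u ∈ R.dom, ∃ v ∈ R.dom, u ∈ M ∧ v ∈ M ∧ R.left u ≤ R.left v ∧ R.left v ≤ R.right u ∧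
      R.right u ≤ R.right v ∧
      ∀ w ∈ R.dom, w ∈ M → R.left w ≤ R.left v ∧ R.right u ≤ R.right w := by
  have hne' : (R.dom ∩ M).Nonempty := hne
  obtain ⟨v, hv, hv'⟩ := Set.exists_max_image _ R.left (Set.toFinite (R.dom ∩ M)) hne'
  obtain ⟨u, hu, hu'⟩ := Set.exists_min_image _ R.right (Set.toFinite (R.dom ∩ M)) hne'
  refine ⟨u, hu.1, v, hv.1, hu.2, hv.2, hv' u hu, ?_, hu' v hv,
    fun w hw hwM => ⟨hv' w ⟨hw, hwM⟩, hu' w ⟨hw, hwM⟩⟩⟩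
  refine R.left_le_right_of_adj_or_eq hu.1 hv.1 ?_
  by_cases h : u = v
  · exact Or.inl h
  · exact Or.inr (adj_of_mem_maximal hM hu.2 hv.2 h)

variable {R}

lemma Prec.le_of_mem {K L : Set V} (h : R.Prec K L) {s t : ℝ} (hs : s ∈ R.region K)
    (ht : t ∈ R.region L) : s ≤ t := by
  have h1 : (s : EReal) ≤ R.rightmost K := le_sSup ⟨s, hs, rfl⟩
  have h2 : R.leftmost L ≤ (t : EReal) := sInf_le ⟨t, ht, rfl⟩
  exact EReal.coe_le_coe_iff.1 (h1.trans (h.trans h2))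

open Filter Topology in
-- A common point forces `K` and `L` to have the same pre-drawn vertices, so their regions coincide
-- and `h` shrinks them to `{a}`. Then some pre-drawn interval of `K` must start at `a` and some
-- must end there. Non-adjacent vertices of `K` and `L` are the two common neighbours.
lemma containsSE_of_region_inter [Finite V] {K L : Set V} (hK : Maximal G.IsClique K)
    (hL : Maximal G.IsClique L) (hKL : K ≠ L)
    (h : ∀ s ∈ R.region K, ∀ t ∈ R.region L, s ≤ t) {a : ℝ} (haK : a ∈ R.region K)
    (haL : a ∈ R.region L) : ContainsSE R := by
  have hdom : ∀ v ∈ R.dom, (v ∈ K ↔ v ∈ L) := fun v hv => (haK v hv).symm.trans (haL v hv)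
  have hreg : ∀ t, t ∈ R.region K → t = a := fun t ht =>
    le_antisymm (h t ht a haL) (h a haK t fun v hv => (ht v hv).trans (hdom v hv))
  have hout : ∀ v ∈ R.dom, v ∉ K → ∀ᶠ t in 𝓝 a, t ∉ R.interval v := fun v hv hvK =>
    isClosed_Icc.isOpen_compl.mem_nhds fun hav => hvK ((haK v hv).1 hav)
  -- If no interval of `K` started at `a`, points just to the left of `a` would be covered by the
  -- same intervals and lie in the region.
  obtain ⟨v, hv, hvK, hva⟩ : ∃ v ∈ R.dom, v ∈ K ∧ R.left v = a := by
    by_contra! hcon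
    have hall : ∀ v, ∀ᶠ t in 𝓝[<] a, v ∈ R.dom → (t ∈ R.interval v ↔ v ∈ K) := by
      intro v
      by_cases hv : v ∈ R.dom
      · by_cases hvK : v ∈ K
        · have hav := (haK v hv).2 hvK
          have hlt : R.left v < a := lt_of_le_of_ne hav.1 (hcon v hv hvK)
          filter_upwards [Ioo_mem_nhdsLT hlt] with t ht _
          exact iff_of_true ⟨ht.1.le, ht.2.le.trans hav.2⟩ hvK
        · filter_upwards [nhdsWithin_le_nhds (hout v hv hvK)] with t ht _
          simp [hvK, ht]
      · exact Eventually.of_forall fun t h => absurd h hv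
    obtain ⟨t, ht, hta⟩ := ((eventually_all.2 hall).and self_mem_nhdsWithin).exists
    exact ne_of_lt hta (hreg t ht)
  obtain ⟨u, hu, huK, hua⟩ : ∃ u ∈ R.dom, u ∈ K ∧ R.right u = a := by
    by_contra! hcon
    have hall : ∀ v, ∀ᶠ t in 𝓝[>] a, v ∈ R.dom → (t ∈ R.interval v ↔ v ∈ K) := by
      intro v
      by_cases hv : v ∈ R.dom
      · by_cases hvK : v ∈ K
        · have hav := (haK v hv).2 hvK
          have hlt : a < R.right v := lt_of_le_of_ne hav.2 (hcon v hv hvK).symm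
          filter_upwards [Ioo_mem_nhdsGT hlt] with t ht _
          exact iff_of_true ⟨hav.1.trans ht.1.le, ht.2.le⟩ hvK
        · filter_upwards [nhdsWithin_le_nhds (hout v hv hvK)] with t ht _
          simp [hvK, ht]
      · exact Eventually.of_forall fun t h => absurd h hv
    obtain ⟨t, ht, hta⟩ := ((eventually_all.2 hall).and self_mem_nhdsWithin).exists
    exact ne_of_gt hta (hreg t ht)
  obtain ⟨x, hxK, hxL⟩ := exists_mem_notMem hK hL hKL
  obtain ⟨y, hyL, hyx, hxy⟩ := exists_not_adj hL hxL
  have hyK : y ∉ K := fun hyK => hxy (adj_of_mem_maximal hK hxK hyK hyx.symm)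
  have hadj : ∀ w ∈ R.dom, w ∈ K → G.Adj x w ∧ G.Adj y w := fun w hw hwK => by
    have hwL := (hdom w hw).1 hwK
    exact ⟨adj_of_mem_maximal hK hxK hwK (by rintro rfl; exact hxL hwL),
      adj_of_mem_maximal hL hyL hwL (by rintro rfl; exact hyK hwK)⟩
  exact ⟨u, hu, v, hv, hua.trans hva.symm, x, y, hyx.symm, hxy, (hadj u hu huK).1,
    (hadj v hv hvK).1, (hadj u hu huK).2, (hadj v hv hvK).2⟩

lemma contains1BI_of_walk {x z u v y : V} (h : IsBIPosition R x z u v) (p : G.Walk x z)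
    (hp : ∀ s ∈ p.support, (s ≠ y ∧ ¬ G.Adj s y) ∧ G.Adj u s ∧ G.Adj v s)
    (hu : G.Adj u y) (hv : G.Adj v y) : Contains1BI R := by
  obtain ⟨_, q, rfl, hq, hqs, -⟩ := exists_isInducedPath
    (D := {s | (s ≠ y ∧ ¬ G.Adj s y) ∧ G.Adj u s ∧ G.Adj v s}) (· = z) p hp rfl
  refine ⟨x, _, u, v, h, y, q, ⟨hq, fun s hs => (hqs s hs).1⟩, ?_⟩
  rintro w (rfl | rfl)
  · exact ⟨hu, fun s hs => (hqs s hs).2.1⟩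
  · exact ⟨hv, fun s hs => (hqs s hs).2.2⟩

/-- If no place remains for a clique-point, then there is a blocked intersection. -/
lemma contains1BI_of_region_eq_empty [Finite V] {T : PQTree (Set V)} (hT : IsPQTreeOf G T)
    {M : Set V} (hM : Maximal G.IsClique M) (h : R.region M = ∅) : Contains1BI R := by
  have hreg : ∀ t, t ∉ R.region M := fun t => h ▸ Set.notMem_empty t
  have hne : ∃ v ∈ R.dom, v ∈ M := by
    by_contra! hcon
    obtain ⟨t, -, ht⟩ := R.exists_lt_uncovered 0
    exact hreg t fun v hv => ⟨fun h => absurd h (ht v), fun h => absurd h (hcon v hv)⟩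
  obtain ⟨u, hu, v, hv, huM, hvM, h1, h2, h3, hext⟩ := R.exists_extremal hM hne
  -- `[left v, right u]` is the intersection of the pre-drawn intervals of `M`; since the region is
  -- empty, foreign intervals cover all of it.
  have hcl : ∀ t ∈ Set.Icc (R.left v) (R.right u), ∀ w ∈ R.dom, w ∈ M → t ∈ R.interval w :=
    fun t ht w hw hwM => ⟨(hext w hw hwM).1.trans ht.1, ht.2.trans (hext w hw hwM).2⟩
  have hcov := fun t ht => R.exists_covering_of_notMem_region (hreg t) (hcl t ht)
  obtain ⟨x, hx, hxM, hxt⟩ := hcov _ (Set.left_mem_Icc.2 h2)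
  obtain ⟨z, hz, hzM, hzt⟩ := hcov _ (Set.right_mem_Icc.2 h2)
  obtain ⟨p, hp⟩ := R.exists_walk_of_cover isPreconnected_Icc hcov hx hxM
    ⟨_, Set.left_mem_Icc.2 h2, hxt⟩ hz hzM ⟨_, Set.right_mem_Icc.2 h2, hzt⟩
  obtain ⟨N, hN, hxN⟩ := exists_maximal_clique_mem (G := G) x
  have hMN : M ≠ N := by rintro rfl; exact hxM hxN
  obtain ⟨l, hl, hlMN⟩ : ∃ l ∈ T.orders, Bef l M N := by
    obtain ⟨l, hl⟩ := T.orders_nonempty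
    rcases Bef.total ((hT.mem_order_iff hl).2 hM) ((hT.mem_order_iff hl).2 hN) hMN with h | h
    · exact ⟨l, hl, h⟩
    · exact ⟨_, T.reverse_mem_orders hl, Bef.reverse_iff.2 h⟩
  obtain ⟨y, hyM, -, hy⟩ := hT.exists_separated hl hlMN
  have hy' := hy x z p (fun s hs => (hp s hs).2.1) ⟨N, hlMN, hxN⟩
  have hadj : ∀ w ∈ R.dom, w ∈ M → ∀ s ∈ p.support, G.Adj w s := fun w hw hwM s hs => by
    obtain ⟨hsd, hsM, t, ht, hts⟩ := hp s hs
    exact R.adj_of_mem_interval hw hsd (by rintro rfl; exact hsM hwM) (hcl t ht w hw hwM) hts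
  have hady : ∀ w ∈ R.dom, w ∈ M → G.Adj w y := fun w hw hwM =>
    adj_of_mem_maximal hM hwM hyM (by
      rintro rfl
      exact (hy' x (by simp)).2 (hadj w hw hwM x (by simp)).symm)
  exact contains1BI_of_walk ⟨hx, hz, hu, hv, h1, h2, h3, hxt, hzt⟩ p
    (fun s hs => ⟨hy' s hs, hadj u hu huM s hs, hadj v hv hvM s hs⟩) (hady u hu huM)
    (hady v hv hvM)

end PartialRep

/-! ### Private vertices of a subtree -/

/-- `v` belongs to some but not to all cliques of the subtree `s`. -/
def PQTree.IsPrivate {V : Type*} (s : PQTree (Set V)) (v : V) : Prop :=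
  (∃ L ∈ s.leaves, v ∈ L) ∧ ∃ L ∈ s.leaves, v ∉ L

/-- `a` and `b` are joined by a walk inside `D`. -/
def ReachIn {V : Type*} (G : SimpleGraph V) (D : Set V) (a b : V) : Prop :=
  ∃ p : G.Walk a b, ∀ s ∈ p.support, s ∈ D

namespace ReachIn

variable {V : Type*} {G : SimpleGraph V} {D : Set V} {a b d : V}

lemma refl (ha : a ∈ D) : ReachIn G D a a := ⟨.nil, by simpa using ha⟩

lemma symm (h : ReachIn G D a b) : ReachIn G D b a := by
  obtain ⟨p, hp⟩ := h
  exact ⟨p.reverse, by simpa using hp⟩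

lemma trans (h : ReachIn G D a b) (h' : ReachIn G D b d) : ReachIn G D a d := by
  obtain ⟨p, hp⟩ := h
  obtain ⟨q, hq⟩ := h'
  refine ⟨p.append q, fun s hs => ?_⟩
  rcases (SimpleGraph.Walk.mem_support_append_iff _ _).1 hs with hs | hs
  · exact hp s hs
  · exact hq s hs

lemma of_adj (h : G.Adj a b) (ha : a ∈ D) (hb : b ∈ D) : ReachIn G D a b :=
  ⟨h.toWalk, by simpa [SimpleGraph.Adj.toWalk] using ⟨ha, hb⟩⟩

end ReachIn

namespace IsPQTreeOf

variable {V : Type*} {G : SimpleGraph V} {T s : PQTree (Set V)}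

lemma mem_leaves_of_isPrivate (hT : IsPQTreeOf G T) (hs : PQTree.IsNode s T) {v : V}
    (hv : s.IsPrivate v) {N : Set V} (hN : Maximal G.IsClique N) (hvN : v ∈ N) :
    N ∈ s.leaves := by
  by_contra h
  obtain ⟨⟨L, hL, hvL⟩, M, hM, hvM⟩ := hv
  exact hvM (hT.mem_of_mem_of_mem hs hL hN h hvL hvN hM)

lemma adj_of_isPrivate (hT : IsPQTreeOf G T) (hs : PQTree.IsNode s T) {v t : V}
    (hv : s.IsPrivate v) (ht : ∀ L ∈ s.leaves, t ∈ L) : G.Adj t v := by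
  obtain ⟨⟨L, hL, hvL⟩, M, hM, hvM⟩ := hv
  refine adj_of_mem_maximal (hT.maximal_of_mem hs hL) (ht L hL) hvL ?_
  rintro rfl
  exact hvM (ht M hM)

/-- All cliques of a private vertex lie in the subtree, including one through any edge at it. -/
lemma not_adj_of_isPrivate [Finite V] (hT : IsPQTreeOf G T) (hs : PQTree.IsNode s T) {v w : V}
    (hv : s.IsPrivate v) (hw : ∀ L ∈ s.leaves, w ∉ L) : w ≠ v ∧ ¬ G.Adj w v := by
  refine ⟨?_, fun h => ?_⟩
  · rintro rfl
    obtain ⟨⟨L, hL, hvL⟩, -⟩ := hv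
    exact hw L hL hvL
  · obtain ⟨N, hN, h1, h2⟩ := exists_maximal_clique_of_adj h
    exact hw N (hT.mem_leaves_of_isPrivate hs hv hN h2) h1

/-- A walk leaves the private vertices of a subtree only through a vertex contained in all its
cliques. -/
lemma isPrivate_or_exists_mem [Finite V] (hT : IsPQTreeOf G T) (hs : PQTree.IsNode s T) {x w : V}
    (hx : s.IsPrivate x) (p : G.Walk x w) :
    s.IsPrivate w ∨ ∃ r ∈ p.support, ∀ L ∈ s.leaves, r ∈ L := by
  induction p with
  | nil => exact Or.inl hx
  | @cons x r w h p ih =>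
    by_cases hr : ∀ L ∈ s.leaves, r ∈ L
    · exact Or.inr ⟨r, by simp, hr⟩
    · push Not at hr
      obtain ⟨N, hN, h1, h2⟩ := exists_maximal_clique_of_adj h
      rcases ih ⟨⟨N, hT.mem_leaves_of_isPrivate hs hx hN h1, h2⟩, hr⟩ with h | ⟨q, hq, hqL⟩
      · exact Or.inl h
      · exact Or.inr ⟨q, by simp [hq], hqL⟩

/-- A shortest walk from `y`, avoiding a subtree, to a non-neighbour of some vertex contained in all
cliques of the subtree. -/
lemma exists_path_to_nonadjacent [Finite V] (hT : IsPQTreeOf G T) {n : ℕ}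
    {c : Fin n → PQTree (Set V)} (hQ : PQTree.IsNode (PQTree.qnode n c) T) {i j : Fin n}
    (hij : i ≠ j) {K : Set V} (hK : K ∈ (c i).leaves)
    {y : V} (hy : y ∈ K) (hyD : ∀ L ∈ (c j).leaves, y ∉ L) :
    ∃ w, ∃ q : G.Walk w y, IsInducedPath G q ∧ (∀ s ∈ q.support, ∀ L ∈ (c j).leaves, s ∉ L) ∧
      (∃ t, (∀ L ∈ (c j).leaves, t ∈ L) ∧ ¬ G.Adj t w) ∧
      ∀ s ∈ q.support, s ≠ w → ∀ t, (∀ L ∈ (c j).leaves, t ∈ L) → G.Adj t s := by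
  obtain ⟨t, w, p, hp, ht, htw⟩ := hT.exists_nonadjacent hQ hij hK hy hyD
  obtain ⟨w, q, hw, hq, hqD, hmin⟩ := exists_isInducedPath
    (D := {s | ∀ L ∈ (c j).leaves, s ∉ L})
    (fun w => ∃ t, (∀ L ∈ (c j).leaves, t ∈ L) ∧ ¬ G.Adj t w) p hp ⟨t, ht, htw⟩
  refine ⟨w, q.reverse, hq.reverse, ?_, hw, ?_⟩
  · intro s hs
    exact hqD s (by simpa using hs)
  · intro s hs hsw t ht
    by_contra hts
    exact hmin s (by simpa using hs) hsw ⟨t, ht, hts⟩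

lemma isFATGraph1_of_isPrivate [Finite V] (hT : IsPQTreeOf G T) (hs : PQTree.IsNode s T)
    {x z y t : V} (hx : s.IsPrivate x) (hz : s.IsPrivate z) (hxz : x ≠ z) (hnxz : ¬ G.Adj x z)
    (hy : ∀ L ∈ s.leaves, y ∉ L) (ht : ∀ L ∈ s.leaves, t ∈ L) (hty : ¬ G.Adj t y) :
    ∃ P : G.Walk x z, IsFATGraph1 G x y z P := by
  have hxt := (hT.adj_of_isPrivate hs hx ht).symm
  have htz := hT.adj_of_isPrivate hs hz ht
  refine ⟨.cons hxt (.cons htz .nil), ?_, ?_⟩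
  · refine IsInducedPath.cons (IsInducedPath.cons (isInducedPath_nil z) htz ?_) hxt ?_
    · simpa using htz.ne'
    · simpa using ⟨hxt.ne', hxz.symm, fun h => absurd h hnxz⟩
  · obtain ⟨L, hL, -⟩ := hx.1
    have hty' : t ≠ y := by rintro rfl; exact hy L hL (ht L hL)
    have h1 := hT.not_adj_of_isPrivate hs hx hy
    have h2 := hT.not_adj_of_isPrivate hs hz hy
    simpa [Avoids] using ⟨⟨h1.1.symm, fun h => h1.2 h.symm⟩, ⟨hty', hty⟩, h2.1.symm,
      fun h => h2.2 h.symm⟩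

/-- The path `P₂` is the single edge from `x` to `t`, and `q` serves as `P₁`. Non-adjacency is
automatic: `q` misses the subtree, while `x` and `z` are private. -/
lemma isFATGraph2_of_isPrivate [Finite V] (hT : IsPQTreeOf G T) (hs : PQTree.IsNode s T)
    {x z y t w : V} (hx : s.IsPrivate x) (hz : s.IsPrivate z) (hxz : x ≠ z)
    (hnxz : ¬ G.Adj x z) (ht : ∀ L ∈ s.leaves, t ∈ L) (htw : ¬ G.Adj t w) (hwy : w ≠ y)
    {q : G.Walk w y} (hq : IsInducedPath G q) (hqs : ∀ r ∈ q.support, ∀ L ∈ s.leaves, r ∉ L)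
    (hqt : ∀ r ∈ q.support, r ≠ w → G.Adj t r) (hxt : G.Adj x t) :
    IsFATGraph2 G x y z t w hxt.toWalk q := by
  have hav : ∀ v, s.IsPrivate v → Avoids G v {r | r ∈ q.support} := fun v hv r hr =>
    hT.not_adj_of_isPrivate hs hv (hqs r hr)
  have hx' : ∀ r ∈ hxt.toWalk.support, r ≠ t → r = x := by
    intro r hr hrt
    simpa [SimpleGraph.Adj.toWalk, hrt] using hr
  refine ⟨⟨hq, hav z hz⟩, hwy, ?_, htw, hT.adj_of_isPrivate hs hz ht, hqt, hxt.ne, ?_, ?_, ?_⟩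
  · rintro rfl
    obtain ⟨L, hL, -⟩ := hx.1
    exact hqs w (by simp) L hL (ht L hL)
  · exact (isInducedPath_nil t).cons hxt (by simpa using hxt.ne')
  · intro r hr hrt
    rw [hx' r hr hrt]
    simpa [Avoids] using ⟨hxz.symm, fun h => hnxz h.symm⟩
  · intro r hr hrt
    rw [hx' r hr hrt]
    exact hav x hx

end IsPQTreeOf

/-! ### Assembling the obstructions for two subtrees -/

section TwoSubtrees

variable {V : Type*} [Finite V] {G : SimpleGraph V} {R : PartialRep G} {T : PQTree (Set V)}
  {n : ℕ} {c : Fin n → PQTree (Set V)}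

lemma containsFAT_of_between (hT : IsPQTreeOf G T)
    (hQ : PQTree.IsNode (PQTree.qnode n c) T) {i j : Fin n} (hij : i ≠ j) {K : Set V}
    (hK : K ∈ (c i).leaves) {x y z : V} (hyK : y ∈ K) (hyj : ∀ L ∈ (c j).leaves, y ∉ L)
    (hx : (c j).IsPrivate x) (hz : (c j).IsPrivate z) (hxz : x ≠ z) (hnxz : ¬ G.Adj x z)
    (hxR : x ∈ R.dom) (hyR : y ∈ R.dom) (hzR : z ∈ R.dom) (hb : R.Between x y z) :
    Contains1FAT R ∨ Contains2FAT R := by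
  have hj : PQTree.IsNode (c j) T := (PQTree.IsNode.qchild n c j .root).trans hQ
  obtain ⟨w, q, hq, hqj, ⟨t, ht, htw⟩, hmin⟩ := hT.exists_path_to_nonadjacent hQ hij hK hyK hyj
  by_cases hwy : w = y
  · left
    subst hwy
    exact ⟨x, hxR, w, hyR, z, hzR, hb,
      hT.isFATGraph1_of_isPrivate hj hx hz hxz hnxz hyj ht htw⟩
  · right
    exact ⟨x, hxR, y, hyR, z, hzR, hb, t, w, _, q, hT.isFATGraph2_of_isPrivate hj hx hz hxz hnxz ht
      htw hwy hq hqj (fun r hr hrw => hmin r hr hrw t ht) (hT.adj_of_isPrivate hj hx ht).symm⟩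

/-- Let `D` consist of the common neighbours of `u` and `v` outside the closed neighbourhood of `y`;
it contains all private vertices. A connection of `x` and `z` inside `D` gives 1-BI. Otherwise every
universal vertex is adjacent to `y`, since one that is not would lie in `D` and link `x` to `z`. So
the path to a non-neighbour of a universal vertex is non-trivial, which gives 2-BI. -/
lemma containsBI_of_isPrivate (hT : IsPQTreeOf G T)
    (hQ : PQTree.IsNode (PQTree.qnode n c) T) {i j : Fin n} (hij : i ≠ j) {K : Set V}
    (hK : K ∈ (c i).leaves) {x y z u v : V} (hyK : y ∈ K) (hyj : ∀ L ∈ (c j).leaves, y ∉ L)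
    (hx : (c j).IsPrivate x) (hz : (c j).IsPrivate z) (huK : u ∈ K) (hvK : v ∈ K)
    (hu : ∀ L ∈ (c j).leaves, u ∈ L) (hv : ∀ L ∈ (c j).leaves, v ∈ L)
    (hpos : IsBIPosition R x z u v) : Contains1BI R ∨ Contains2BI R := by
  have hj : PQTree.IsNode (c j) T := (PQTree.IsNode.qchild n c j .root).trans hQ
  have hi : PQTree.IsNode (c i) T := (PQTree.IsNode.qchild n c i .root).trans hQ
  obtain ⟨L, hL, -⟩ := hx.1
  have hLm := hT.maximal_of_mem hj hL
  have hUy : ∀ t, (∀ L ∈ (c j).leaves, t ∈ L) → t ≠ y := by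
    rintro t ht rfl
    exact hyj L hL (ht L hL)
  have huy := adj_of_mem_maximal (hT.maximal_of_mem hi hK) huK hyK (hUy u hu)
  have hvy := adj_of_mem_maximal (hT.maximal_of_mem hi hK) hvK hyK (hUy v hv)
  set D : Set V := {s | (s ≠ y ∧ ¬ G.Adj s y) ∧ G.Adj u s ∧ G.Adj v s} with hD
  have hprivD : ∀ r, (c j).IsPrivate r → r ∈ D := fun r hr => by
    have h := hT.not_adj_of_isPrivate hj hr hyj
    exact ⟨⟨h.1.symm, fun h' => h.2 h'.symm⟩, hT.adj_of_isPrivate hj hr hu,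
      hT.adj_of_isPrivate hj hr hv⟩
  by_cases hreach : ReachIn G D x z
  · obtain ⟨p, hp⟩ := hreach
    exact Or.inl (PartialRep.contains1BI_of_walk hpos p hp huy hvy)
  have hxz : x ≠ z := by
    rintro rfl
    exact hreach (.refl (hprivD x hx))
  have hnxz : ¬ G.Adj x z := fun h => hreach (.of_adj h (hprivD x hx) (hprivD z hz))
  have hUadj : ∀ t, (∀ L ∈ (c j).leaves, t ∈ L) → G.Adj t y := by
    intro t ht
    by_contra hty
    have htD : t ∈ D := by
      refine ⟨⟨hUy t ht, hty⟩, adj_of_mem_maximal hLm (hu L hL) (ht L hL) ?_,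
        adj_of_mem_maximal hLm (hv L hL) (ht L hL) ?_⟩
      · rintro rfl; exact hty huy
      · rintro rfl; exact hty hvy
    exact hreach (.trans (.of_adj (hT.adj_of_isPrivate hj hx ht).symm (hprivD x hx) htD)
      (.of_adj (hT.adj_of_isPrivate hj hz ht) htD (hprivD z hz)))
  right
  obtain ⟨w, q, hq, hqj, hw, hmin⟩ := hT.exists_path_to_nonadjacent hQ hij hK hyK hyj
  -- If `u` or `v` misses `w`, that vertex itself is taken as `t`. The other one may then miss `w`
  -- too, which is the exception granted for `x₁` in 2-BI.
  obtain ⟨t, ht, htw, htuv⟩ : ∃ t, (∀ L ∈ (c j).leaves, t ∈ L) ∧ ¬ G.Adj t w ∧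
      ((G.Adj u w ∧ G.Adj v w) ∨ u = t ∨ v = t) := by
    by_cases huw : G.Adj u w
    · by_cases hvw : G.Adj v w
      · obtain ⟨t, ht, htw⟩ := hw
        exact ⟨t, ht, htw, Or.inl ⟨huw, hvw⟩⟩
      · exact ⟨v, hv, hvw, Or.inr (Or.inr rfl)⟩
    · exact ⟨u, hu, huw, Or.inr (Or.inl rfl)⟩
  have hwy : w ≠ y := by
    rintro rfl
    exact htw (hUadj t ht)
  refine ⟨x, z, u, v, hpos, y, t, w, _, q, hT.isFATGraph2_of_isPrivate hj hx hz hxz hnxz ht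
      htw hwy hq hqj (fun r hr hrw => hmin r hr hrw t ht) (hT.adj_of_isPrivate hj hx ht).symm, ?_⟩
  intro r hr
  have hrU : ∀ L ∈ (c j).leaves, r ∈ L := by
    rcases hr with rfl | rfl
    · exact hu
    · exact hv
  by_cases hrt : r = t
  · exact Or.inl hrt
  right
  rintro s (rfl | hs | hs)
  · exact Or.inl (hT.adj_of_isPrivate hj hz hrU)
  · have hs' : s = x ∨ s = t := by simpa [SimpleGraph.Adj.toWalk] using hs
    rcases hs' with rfl | rfl
    · exact Or.inl (hT.adj_of_isPrivate hj hx hrU)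
    · exact Or.inl (adj_of_mem_maximal hLm (hrU L hL) (ht L hL) hrt)
  · by_cases hsw : s = w
    · subst hsw
      rcases htuv with ⟨h1, h2⟩ | h
      · rcases hr with rfl | rfl
        · exact Or.inl h1
        · exact Or.inl h2
      · exact Or.inr ⟨rfl, h⟩
    · exact Or.inl (hmin s hs hsw r hrU)

/-- If all pre-drawn vertices of `L` belonged to `K` as well, then the clique-point of `L` could not
be kept away from the segment between the clique-points of `K` and `L'`. -/
lemma exists_predrawn_notMem (hT : IsPQTreeOf G T) {s : PQTree (Set V)}
    (hs : PQTree.IsNode s T) {K L L' : Set V} (hK : Maximal G.IsClique K) (hKs : K ∉ s.leaves)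
    (hL : L ∈ s.leaves) (hL' : L' ∈ s.leaves) {b d : ℝ} (hb : b ∈ R.region K)
    (hd : d ∈ R.region L') (hbd : ∀ t ∈ Set.uIcc b d, t ∉ R.region L) :
    ∃ x ∈ R.dom, x ∈ L ∧ x ∉ K := by
  by_contra! hcon
  -- Under `hcon`, pre-drawn vertices of `L` lie in `K`, hence are universal and cover the whole
  -- segment. Foreign intervals thus cover it as well and yield a walk outside `L` from a private
  -- vertex to a vertex of `K`; but private vertices can be left only through universal ones, which
  -- lie in `L`.
  have hcov : ∀ t ∈ Set.uIcc b d, ∃ v ∈ R.dom, v ∉ L ∧ t ∈ R.interval v := by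
    intro t ht
    refine R.exists_covering_of_notMem_region (hbd t ht) fun v hv hvL => ?_
    have hvK := hcon v hv hvL
    have h1 := (hb v hv).2 hvK
    have h2 := (hd v hv).2 (hT.mem_of_mem_of_mem hs hL hK hKs hvL hvK hL')
    exact Set.uIcc_subset_Icc h1 h2 ht
  obtain ⟨y, hy, hyL, hyb⟩ := hcov b Set.left_mem_uIcc
  obtain ⟨z, hz, hzL, hzd⟩ := hcov d Set.right_mem_uIcc
  obtain ⟨p, hp⟩ := R.exists_walk_of_cover isPreconnected_uIcc hcov hz hzL
    ⟨d, Set.right_mem_uIcc, hzd⟩ hy hyL ⟨b, Set.left_mem_uIcc, hyb⟩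
  rcases hT.isPrivate_or_exists_mem hs ⟨⟨L', hL', (hd z hz).1 hzd⟩, L, hL, hzL⟩ p with
    h | ⟨r, hr, hrs⟩
  · exact hKs (hT.mem_leaves_of_isPrivate hs h hK ((hb y hy).1 hyb))
  · exact (hp r hr).2.1 (hrs L hL)

/-- All pre-drawn vertices of `K` are universal, so their intersection `[left v, right u]` contains
`a` and `d`, while the region of `K` lies strictly between `a` and `d`. Foreign intervals therefore
cover `[left v, a]` and `[d, right u]`, giving walks from `x` and `z` to vertices `x'` and `z'` at
the two ends. -/
lemma containsBI_of_forall_mem (hT : IsPQTreeOf G T)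
    (hQ : PQTree.IsNode (PQTree.qnode n c) T) {i j : Fin n} (hij : i ≠ j) {K L L' : Set V}
    (hK : K ∈ (c i).leaves) (hL : L ∈ (c j).leaves) (hL' : L' ∈ (c j).leaves)
    {a d : ℝ} (ha : a ∈ R.region L) (hd : d ∈ R.region L')
    (haK : ∀ t ∈ R.region K, a < t) (hdK : ∀ t ∈ R.region K, t < d) (had : a ≤ d)
    (hKj : ∀ v ∈ R.dom, v ∈ K → ∀ L ∈ (c j).leaves, v ∈ L)
    {x z : V} (hx : x ∈ R.dom) (hxL : x ∈ L) (hxp : (c j).IsPrivate x) (hxK : x ∉ K)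
    (hz : z ∈ R.dom) (hzL : z ∈ L') (hzp : (c j).IsPrivate z) (hzK : z ∉ K) :
    Contains1BI R ∨ Contains2BI R := by
  have hj : PQTree.IsNode (c j) T := (PQTree.IsNode.qchild n c j .root).trans hQ
  have hi : PQTree.IsNode (c i) T := (PQTree.IsNode.qchild n c i .root).trans hQ
  have hKm := hT.maximal_of_mem hi hK
  have hKnj : K ∉ (c j).leaves := fun h =>
    hij (PQTree.qnode_leaves_disjoint (hQ.nodupOrders hT.nodupOrders) hK h)
  have hne : ∃ v ∈ R.dom, v ∈ K := by
    by_contra! hcon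
    obtain ⟨t, hta, ht⟩ := R.exists_lt_uncovered a
    have : t ∈ R.region K := fun v hv =>
      ⟨fun h => absurd h (ht v), fun h => absurd h (hcon v hv)⟩
    exact (haK t this).not_gt hta
  obtain ⟨u, hu, v, hv, huK, hvK, h1, h2, h3, hext⟩ := R.exists_extremal hKm hne
  have huj := hKj u hu huK
  have hvj := hKj v hv hvK
  have hva : R.left v ≤ a := ((ha v hv).2 (hvj L hL)).1
  have hud : d ≤ R.right u := ((hd u hu).2 (huj L' hL')).2
  have hcl : ∀ t, R.left v ≤ t → t ≤ R.right u → ∀ w ∈ R.dom, w ∈ K → t ∈ R.interval w :=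
    fun t ht ht' w hw hwM => ⟨(hext w hw hwM).1.trans ht, ht'.trans (hext w hw hwM).2⟩
  have hcov₁ : ∀ t ∈ Set.Icc (R.left v) a, ∃ s ∈ R.dom, s ∉ K ∧ t ∈ R.interval s := fun t ht =>
    R.exists_covering_of_notMem_region (fun h => (haK t h).not_ge ht.2)
      (hcl t ht.1 (ht.2.trans (had.trans hud)))
  have hcov₂ : ∀ t ∈ Set.Icc d (R.right u), ∃ s ∈ R.dom, s ∉ K ∧ t ∈ R.interval s := fun t ht =>
    R.exists_covering_of_notMem_region (fun h => (hdK t h).not_ge ht.1)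
      (hcl t (hva.trans (had.trans ht.1)) ht.2)
  obtain ⟨x', hx', hx'K, hx't⟩ := hcov₁ _ (Set.left_mem_Icc.2 hva)
  obtain ⟨z', hz', hz'K, hz't⟩ := hcov₂ _ (Set.right_mem_Icc.2 hud)
  obtain ⟨p, hp⟩ := R.exists_walk_of_cover isPreconnected_Icc hcov₁ hx hxK
    ⟨a, Set.right_mem_Icc.2 hva, (ha x hx).2 hxL⟩ hx' hx'K ⟨_, Set.left_mem_Icc.2 hva, hx't⟩
  obtain ⟨q, hq⟩ := R.exists_walk_of_cover isPreconnected_Icc hcov₂ hz hzK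
    ⟨d, Set.left_mem_Icc.2 hud, (hd z hz).2 hzL⟩ hz' hz'K ⟨_, Set.right_mem_Icc.2 hud, hz't⟩
  obtain ⟨l, hl, hKl⟩ := hT.exists_order_bef hj hKm hKnj
  obtain ⟨y, hyK, hyl, hy⟩ := hT.exists_separated hl (hKl L hL)
  have hyj : ∀ L ∈ (c j).leaves, y ∉ L := fun L hL => hyl L (hKl L hL)
  have hpos : IsBIPosition R x' z' u v := ⟨hx', hz', hu, hv, h1, h2, h3, hx't, hz't⟩
  have hUy : ∀ t, (∀ L ∈ (c j).leaves, t ∈ L) → t ≠ y := by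
    rintro t ht rfl
    exact hyj L hL (ht L hL)
  have huy := adj_of_mem_maximal hKm huK hyK (hUy u huj)
  have hvy := adj_of_mem_maximal hKm hvK hyK (hUy v hvj)
  have hadj : ∀ w ∈ R.dom, w ∈ K → ∀ s ∈ R.dom, s ∉ K → ∀ t ∈ R.interval s, R.left v ≤ t →
      t ≤ R.right u → G.Adj w s := fun w hw hwK s hs hsK t hts ht ht' =>
    R.adj_of_mem_interval hw hs (by rintro rfl; exact hsK hwK) (hcl t ht ht' w hw hwK) hts
  set D : Set V := {s | (s ≠ y ∧ ¬ G.Adj s y) ∧ G.Adj u s ∧ G.Adj v s} with hD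
  have hpD : ∀ s ∈ p.support, s ∈ D := fun s hs => by
    obtain ⟨hsR, hsK, t, ht, hts⟩ := hp s hs
    have ht' := ht.2.trans (had.trans hud)
    exact ⟨hy x x' p (fun s hs => (hp s hs).2.1) ⟨L, hKl L hL, hxL⟩ s hs,
      hadj u hu huK s hsR hsK t hts ht.1 ht', hadj v hv hvK s hsR hsK t hts ht.1 ht'⟩
  have hqD : ∀ s ∈ q.support, s ∈ D := fun s hs => by
    obtain ⟨hsR, hsK, t, ht, hts⟩ := hq s hs
    have ht' := hva.trans (had.trans ht.1)
    exact ⟨hy z z' q (fun s hs => (hq s hs).2.1) ⟨L', hKl L' hL', hzL⟩ s hs,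
      hadj u hu huK s hsR hsK t hts ht' ht.2, hadj v hv hvK s hsR hsK t hts ht' ht.2⟩
  by_cases hreach : ReachIn G D x' z'
  · obtain ⟨p, hp⟩ := hreach
    exact Or.inl (PartialRep.contains1BI_of_walk hpos p hp huy hvy)
  have hpr : ReachIn G D x x' := ⟨p, hpD⟩
  have hqr : ReachIn G D z z' := ⟨q, hqD⟩
  -- A universal vertex in `D` would join `x` and `z`, hence `x'` and `z'`. So neither walk meets a
  -- universal vertex, and its end stays private.
  have hnr : ∀ r ∈ D, (∀ L ∈ (c j).leaves, r ∈ L) → False := fun r hr hrj =>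
    hreach (hpr.symm.trans (.trans
      (.of_adj (hT.adj_of_isPrivate hj hxp hrj).symm (hpD x (by simp)) hr)
      (.trans (.of_adj (hT.adj_of_isPrivate hj hzp hrj) hr (hqD z (by simp))) hqr)))
  have hx'p : (c j).IsPrivate x' := (hT.isPrivate_or_exists_mem hj hxp p).resolve_right
    fun ⟨r, hr, hrj⟩ => hnr r (hpD r hr) hrj
  have hz'p : (c j).IsPrivate z' := (hT.isPrivate_or_exists_mem hj hzp q).resolve_right
    fun ⟨r, hr, hrj⟩ => hnr r (hqD r hr) hrj
  exact containsBI_of_isPrivate hT hQ hij hK hyK hyj hx'p hz'p huK hvK huj hvj hpos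

/-- The clique `K` of one subtree of a Q-node is forced between two cliques of another subtree. -/
lemma containsObstruction_of_prec_prec (hT : IsPQTreeOf G T)
    (hQ : PQTree.IsNode (PQTree.qnode n c) T) {i j : Fin n} (hij : i ≠ j) {K L L' : Set V}
    (hK : K ∈ (c i).leaves) (hL : L ∈ (c j).leaves) (hL' : L' ∈ (c j).leaves)
    (hLK : R.Prec L K) (hKL' : R.Prec K L') :
    ContainsSE R ∨ Contains1FAT R ∨ Contains2FAT R ∨ Contains1BI R ∨ Contains2BI R := by
  have hj : PQTree.IsNode (c j) T := (PQTree.IsNode.qchild n c j .root).trans hQ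
  have hi : PQTree.IsNode (c i) T := (PQTree.IsNode.qchild n c i .root).trans hQ
  have hKm := hT.maximal_of_mem hi hK
  have hLm := hT.maximal_of_mem hj hL
  have hLm' := hT.maximal_of_mem hj hL'
  have hKnj : K ∉ (c j).leaves := fun h =>
    hij (PQTree.qnode_leaves_disjoint (hQ.nodupOrders hT.nodupOrders) hK h)
  -- For an empty region ◁ holds vacuously and carries no geometric information, so this case is
  -- removed beforehand.
  have hne : ∀ M, Maximal G.IsClique M → Contains1BI R ∨ (R.region M).Nonempty := fun M hM =>
    (Set.eq_empty_or_nonempty (R.region M)).imp_left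
      (PartialRep.contains1BI_of_region_eq_empty hT hM)
  rcases hne K hKm with h | ⟨b, hb⟩
  · tauto
  rcases hne L hLm with h | ⟨a, ha⟩
  · tauto
  rcases hne L' hLm' with h | ⟨d, hd⟩
  · tauto
  by_cases hSE : ContainsSE R
  · exact Or.inl hSE
  right
  have hlt₁ : ∀ s ∈ R.region L, ∀ t ∈ R.region K, s < t := fun s hs t ht =>
    (hLK.le_of_mem hs ht).lt_of_ne (by
      rintro rfl
      exact hSE (PartialRep.containsSE_of_region_inter hLm hKm
        (by rintro rfl; exact hKnj hL) (fun _ h _ h' => hLK.le_of_mem h h') hs ht))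
  have hlt₂ : ∀ s ∈ R.region K, ∀ t ∈ R.region L', s < t := fun s hs t ht =>
    (hKL'.le_of_mem hs ht).lt_of_ne (by
      rintro rfl
      exact hSE (PartialRep.containsSE_of_region_inter hKm hLm'
        (by rintro rfl; exact hKnj hL') (fun _ h _ h' => hKL'.le_of_mem h h') hs ht))
  have hab := hlt₁ a ha b hb
  have hbd := hlt₂ b hb d hd
  obtain ⟨x, hx, hxL, hxK⟩ : ∃ x ∈ R.dom, x ∈ L ∧ x ∉ K := by
    refine exists_predrawn_notMem hT hj hKm hKnj hL hL' hb hd fun t ht htL => ?_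
    rw [Set.uIcc_of_le hbd.le] at ht
    exact (hlt₁ t htL b hb).not_ge ht.1
  obtain ⟨z, hz, hzL, hzK⟩ : ∃ z ∈ R.dom, z ∈ L' ∧ z ∉ K := by
    refine exists_predrawn_notMem hT hj hKm hKnj hL' hL hb ha fun t ht htL => ?_
    rw [Set.uIcc_of_ge hab.le] at ht
    exact (hlt₂ b hb t htL).not_ge ht.2
  -- A universal interval contains `a` and `d`, hence also `b`, and so belongs to `K`.
  have hcross : ∀ v ∈ R.dom, v ∉ K → ¬ ∀ L ∈ (c j).leaves, v ∈ L := fun v hv hvK hvj =>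
    hvK ((hb v hv).1 (R.mem_interval_of_mem_of_mem ((ha v hv).2 (hvj L hL))
      ((hd v hv).2 (hvj L' hL')) hab.le hbd.le))
  have hxp : (c j).IsPrivate x := ⟨⟨L, hL, hxL⟩, by simpa using hcross x hx hxK⟩
  have hzp : (c j).IsPrivate z := ⟨⟨L', hL', hzL⟩, by simpa using hcross z hz hzK⟩
  by_cases hKj : ∀ v ∈ R.dom, v ∈ K → ∀ L ∈ (c j).leaves, v ∈ L
  · have := containsBI_of_forall_mem hT hQ hij hK hL hL' ha hd (hlt₁ a ha)
      (fun t ht => hlt₂ t ht d hd) (hab.le.trans hbd.le) hKj hx hxL hxp hxK hz hzL hzp hzK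
    tauto
  · push Not at hKj
    obtain ⟨y, hy, hyK, M, hM, hyM⟩ := hKj
    -- As `K` lies outside `c j`, its vertex `y` is in all cliques of `c j` or in none.
    have hyj : ∀ L ∈ (c j).leaves, y ∉ L := fun N hN hyN =>
      hyM (hT.mem_of_mem_of_mem hj hN hKm hKnj hyN hyK hM)
    have hyx := hT.not_adj_of_isPrivate hj hxp hyj
    have hyz := hT.not_adj_of_isPrivate hj hzp hyj
    have hxy : R.LeftOf x y := R.leftOf_of_not_adj hx hy hyx.1.symm (fun h => hyx.2 h.symm)
      ((ha x hx).2 hxL) ((hb y hy).2 hyK) hab.le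
    have hyz' : R.LeftOf y z := R.leftOf_of_not_adj hy hz hyz.1 hyz.2
      ((hb y hy).2 hyK) ((hd z hz).2 hzL) hbd.le
    have hxz : R.right x < R.left z := hxy.trans_le ((R.left_le_right y hy).trans hyz'.le)
    have hne : x ≠ z := by
      rintro rfl
      exact (R.left_le_right x hx).not_gt hxz
    have hnadj : ¬ G.Adj x z := fun h =>
      (R.left_le_right_of_adj_or_eq hx hz (Or.inr h)).not_gt hxz
    have := containsFAT_of_between hT hQ hij hK hyK hyj hxp hzp hne hnadj hx hy hz
      (Or.inl ⟨hxy, hyz'⟩)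
    tauto

end TwoSubtrees

theorem mainTheorem4 {V : Type*} [Finite V] (G : SimpleGraph V) (R : PartialRep G)
    (T : PQTree (Set V)) (hT : IsPQTreeOf G T)
    (n : ℕ) (c : Fin n → PQTree (Set V)) (hQ : PQTree.IsNode (PQTree.qnode n c) T)
    (S : Finset (Set V)) (hcard : S.card ≤ 3) (hS : CreatesQObstruction R c (S : Set (Set V)))
    (hsub : ∃ i j : Fin n, i ≠ j ∧ ∀ K ∈ S, K ∈ (c i).leaves ∨ K ∈ (c j).leaves) :
    ContainsSE R ∨ Contains1FAT R ∨ Contains2FAT R ∨ Contains1BI R ∨ Contains2BI R := by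
  classical
  have hdisj {a b : Fin n} {M : Set V} (ha : M ∈ (c a).leaves) (hb : M ∈ (c b).leaves) : a = b :=
    PQTree.qnode_leaves_disjoint (hQ.nodupOrders hT.nodupOrders) ha hb
  obtain ⟨i, j, hij, hsub⟩ : ∃ i j : Fin n, i < j ∧
      ∀ K ∈ S, K ∈ (c i).leaves ∨ K ∈ (c j).leaves := by
    obtain ⟨i, j, hij, h⟩ := hsub
    rcases lt_or_gt_of_ne hij with h' | h'
    · exact ⟨i, j, h', h⟩
    · exact ⟨j, i, h', fun K hK => (h K hK).symm⟩
  have key : ∀ i' j' : Fin n, i' < j' → ∀ K ∈ S, ∀ L ∈ S, K ∈ (c i').leaves → L ∈ (c j').leaves →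
      K ∈ (c i).leaves ∧ L ∈ (c j).leaves := by
    intro i' j' hij' K hK L hL hKi hLj
    rcases hsub K hK with h1 | h1 <;> rcases hsub L hL with h2 | h2
    · exact absurd ((hdisj hKi h1).trans (hdisj h2 hLj)) hij'.ne
    · exact ⟨h1, h2⟩
    · have e1 := hdisj hKi h1
      have e2 := hdisj hLj h2
      subst e1 e2
      exact absurd hij' hij.not_gt
    · exact absurd ((hdisj hKi h1).trans (hdisj h2 hLj)) hij'.ne
  obtain ⟨-, ⟨i₁, j₁, h₁, K₁, hK₁, L₁, hL₁, hKi₁, hLj₁, hp₁⟩,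
    i₂, j₂, h₂, K₂, hK₂, L₂, hL₂, hKi₂, hLj₂, hp₂⟩ := hS
  obtain ⟨hK₁i, hL₁j⟩ := key i₁ j₁ h₁ K₁ hK₁ L₁ hL₁ hKi₁ hLj₁
  obtain ⟨hK₂i, hL₂j⟩ := key i₂ j₂ h₂ K₂ hK₂ L₂ hL₂ hKi₂ hLj₂
  have hne : ∀ K L : Set V, K ∈ (c i).leaves → L ∈ (c j).leaves → K ≠ L := by
    rintro K L hK hL rfl
    exact hij.ne (hdisj hK hL)
  by_cases hK : K₁ = K₂
  · subst hK
    exact containsObstruction_of_prec_prec hT hQ hij.ne hK₁i hL₁j hL₂j hp₁ hp₂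
  by_cases hL : L₁ = L₂
  · subst hL
    -- The roles of the subtrees are exchanged: `L₁` is squeezed between `K₂` and `K₁`.
    exact containsObstruction_of_prec_prec hT hQ hij.ne' hL₁j hK₂i hK₁i hp₂ hp₁
  -- Without a shared clique, the two violating pairs would consist of four distinct members of `S`.
  have hfour : ({K₁, K₂, L₁, L₂} : Finset (Set V)).card = 4 := by
    rw [Finset.card_insert_of_notMem, Finset.card_insert_of_notMem, Finset.card_pair hL]
    · simp [hne K₂ L₁ hK₂i hL₁j, hne K₂ L₂ hK₂i hL₂j]
    · simp [hK, hne K₁ L₁ hK₁i hL₁j, hne K₁ L₂ hK₁i hL₂j]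
  have hle : ({K₁, K₂, L₁, L₂} : Finset (Set V)).card ≤ S.card := by
    refine Finset.card_le_card ?_
    intro M hM
    simp only [Finset.mem_insert, Finset.mem_singleton] at hM
    rcases hM with rfl | rfl | rfl | rfl
    · exact hK₁
    · exact hK₂
    · exact hL₁
    · exact hL₂
  omega
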